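/- Let $S\subset\mathbb R^d$ be a compact $C^\infty$ hypersurface (possibly with smooth boundary), let $\sigma$ be its induced Lebesgue (surface) measure, and assume that for some $\rho>0$ the Fourier transform $\widehat{d\sigma}(\xi)=\int_S e^{-2\pi i x\cdot\xi}\,d\sigma(x)$ satisfies $|\widehat{d\sigma}(\xi)|\le C(1+|\xi|)^{-\rho}$ for all $\xi\in\mathbb R^d$. There is a constant $C_{d,\rho}>0$, depending only on $d$ and $\rho$, such that the following holds. Let $1\le p\le q\le 2$ and $0<\alpha<1$, and suppose that there is a constant $C_\alpha$ such that the local restriction estimate $$\|\hat f|_S\|_{L^q(S,d\sigma)}\le C_\alpha R^\alpha\|f\|_{L^p(B_R)}$$ holds for every $R\ge 1$, every ball $B_R\subset\mathbb R^d$ of radius $R$ and every smooth complex-valued function $f$ supported in $B_R$. Then for every $s\ge 1$ with $$\frac1s>\frac1p+\frac{C_{d,\rho}}{-\ln\alpha}$$ there is a constant $C$ such that $$\|\hat f|_S\|_{L^q(S,d\sigma)}\le C\|f\|_{L^s(\mathbb R^d)}\qquad\text{for all } f\in L^1(\mathbb R^d)\cap L^s(\mathbb R^d).$$ (Since $s\ge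 1$ and $p\le 2$, the condition on $s$ can only be met when $\alpha$ is sufficiently small in terms of $C_{d,\rho}$.) -/

import Mathlib

open MeasureTheory
open scoped FourierTransform ContDiff ENNReal

noncomputable section

/-- A compact `C^∞` hypersurface of `ℝ^d`, possibly with boundary: a compact set which, near each
of its points, is carried by a smooth diffeomorphism between open subsets of `ℝ^d` onto an open
piece of a coordinate hyperplane or of a coordinate half-hyperplane. -/
structure IsCompactSmoothHypersurface {d : ℕ} (S : Set (EuclideanSpace ℝ (Fin d))) : Prop where
  isCompact : IsCompact S
  exists_chart : ∀ x ∈ S,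
    ∃ e : OpenPartialHomeomorph (EuclideanSpace ℝ (Fin d)) (EuclideanSpace ℝ (Fin d)),
      x ∈ e.source ∧ ContDiffOn ℝ ∞ e e.source ∧ ContDiffOn ℝ ∞ e.symm e.target ∧
      ∃ i : Fin d, e.IsImage S {y | y i = 0} ∨
        ∃ j : Fin d, j ≠ i ∧ e.IsImage S {y | y i = 0 ∧ 0 ≤ y j}

/-- The induced Lebesgue (surface) measure `dσ` on `S`, as a measure on `ℝ^d`: the
`(d - 1)`-dimensional Hausdorff measure, in the Euclidean normalization, restricted to `S`. -/
def surfaceMeasure {d : ℕ} (S : Set (EuclideanSpace ℝ (Fin d))) :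
    Measure (EuclideanSpace ℝ (Fin d)) :=
  (Measure.euclideanHausdorffMeasure (d - 1)).restrict S

/-- The Fourier transform of the surface measure,
`ξ ↦ ∫_S e^{-2π i x·ξ} dσ(x)`. -/
def surfaceFourier {d : ℕ} (S : Set (EuclideanSpace ℝ (Fin d)))
    (ξ : EuclideanSpace ℝ (Fin d)) : ℂ :=
  ∫ x, Complex.exp (((-2 * Real.pi * inner ℝ x ξ : ℝ) : ℂ) * Complex.I) ∂(surfaceMeasure S)

/-- The decay condition `|dσ^(ξ)| ≲ (1 + |ξ|)^{-ρ}`. -/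
def HasFourierDecay {d : ℕ} (S : Set (EuclideanSpace ℝ (Fin d))) (ρ : ℝ) : Prop :=
  ∃ A : ℝ, ∀ ξ, ‖surfaceFourier S ξ‖ ≤ A * (1 + ‖ξ‖) ^ (-ρ)

/-- The local restriction estimate `‖f^|_S‖_{L^q(S, dσ)} ≤ C_α R^α ‖f‖_{L^p(B_R)}`, for every ball
`B_R` of radius `R ≥ 1` and every smooth `f` supported in `B_R`, with a constant independent of
`R`, of the ball and of `f`. -/
def LocalRestrictionEstimate {d : ℕ} (S : Set (EuclideanSpace ℝ (Fin d))) (p q α : ℝ) : Prop :=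
  ∃ A : ℝ, ∀ R : ℝ, 1 ≤ R → ∀ (c : EuclideanSpace ℝ (Fin d))
    (f : EuclideanSpace ℝ (Fin d) → ℂ), ContDiff ℝ ∞ f → tsupport f ⊆ Metric.ball c R →
      eLpNorm (𝓕 f) (ENNReal.ofReal q) (surfaceMeasure S) ≤
        ENNReal.ofReal (A * R ^ α) *
          eLpNorm f (ENNReal.ofReal p) (volume.restrict (Metric.ball c R))

/-- The global restriction estimate `‖f^|_S‖_{L^q(S, dσ)} ≤ C ‖f‖_{L^s(ℝ^d)}`, for every
`f ∈ L^1(ℝ^d) ∩ L^s(ℝ^d)`; for such `f` the Fourier transform is a continuous function, whose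
restriction to `S` is well defined. -/
def GlobalRestrictionEstimate {d : ℕ} (S : Set (EuclideanSpace ℝ (Fin d))) (s q : ℝ) : Prop :=
  ∃ A : ℝ, ∀ f : EuclideanSpace ℝ (Fin d) → ℂ, Integrable f volume →
    MemLp f (ENNReal.ofReal s) volume →
      eLpNorm (𝓕 f) (ENNReal.ofReal q) (surfaceMeasure S) ≤
        ENNReal.ofReal A * eLpNorm f (ENNReal.ofReal s) volume

end

/-! This is an epsilon-removal argument in the style of Tao, run on the dual side. Let `G` be the
Fourier transform of `g dσ` with `‖g‖_{q'} ≤ 1`. As `σ` is finite with compact support, `G` is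
bounded and Lipschitz, uniformly in `g`, and an `L^{s'}` bound for `G` is equivalent to the claim.
It follows from a weak-type bound `|{|G| > λ}| ≲ λ^{-r}` with `r < s'`.

The local estimate at scale `R` extends, with the same loss `R^α`, to functions carried by a union
of `R`-balls whose separation is a large power of `R` times their number
(`exists_sparse_restriction`). The reason is that a transform `f^` with `f` supported in an `R`-ball
is essentially constant on frequency balls of radius `1/R`. On such a frequency ball the `L^q` norm
of a sum passes to `L^2` by Hölder (`q ≤ 2`), where Fourier decay of `σ` makes different pieces
almost orthogonal; local constancy then returns from `L^2` to `L^q` without loss. Averaging over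
frequency balls and using `p ≤ q` to pass from `ℓ^q` to `ℓ^p` sums finishes the estimate.

Level sets split into few sparse families (`exists_sparse_cover`). Let `n` bound the number of
`λ`-sized balls that fit into the level set, and take radii `r_k = n^{(2c+1)^k}`. Around each point
the mass of the set can grow by at most a factor `n` in total, so among `N` scales one has growth at
most `n^{1/N}`. Each family obeys the dual sparse estimate, which gives `|E| ≲ n^ε λ^{-p'}` with `ε
= 1/N + α p' (2c+1)^N`. Since `n` is about `|E| λ^{-d}`, this self-improves when `ε < 1`
(`exists_volume_superlevel_le`). Choosing `N` proportional to `log (1/α)` makes `ε` of size `1 / log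
(1/α)`, which is the loss in the exponent (`exists_scale_count`). -/

theorem Circle.enorm_smul (z : Circle) (a : ℂ) : ‖z • a‖ₑ = ‖a‖ₑ := by
  rw [← ofReal_norm, ← ofReal_norm, Circle.smul_def, norm_smul, Circle.norm_coe, one_mul]

theorem eLpNorm_le_of_enorm_le {α : Type*} [MeasurableSpace α] {σ : Measure α} {q : ℝ}
    (hq : 0 < q) {h : α → ℂ} {c : ℝ≥0∞} (hc : ∀ x, ‖h x‖ₑ ≤ c) :
    eLpNorm h (ENNReal.ofReal q) σ ≤ c * σ Set.univ ^ (1 / q) := by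
  rw [eLpNorm_eq_lintegral_rpow_enorm_toReal (by simpa using hq) ENNReal.ofReal_ne_top,
    ENNReal.toReal_ofReal hq.le]
  calc _ ≤ (∫⁻ _, c ^ q ∂σ) ^ (1 / q) := by gcongr; exact hc _
    _ = _ := by
      rw [lintegral_const, ENNReal.mul_rpow_of_nonneg _ _ (by positivity), ← ENNReal.rpow_mul,
        mul_one_div_cancel hq.ne', ENNReal.rpow_one]

/-! ### Basic Fourier bounds, extension of the local estimate to `L^p`, and Schwartz cutoffs as
superpositions of characters. -/

section FourierEstimates

variable {V : Type*} [NormedAddCommGroup V] [InnerProductSpace ℝ V] [FiniteDimensional ℝ V]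
  [MeasurableSpace V] [BorelSpace V]

theorem enorm_fourier_le_lintegral (f : V → ℂ) (ξ : V) : ‖𝓕 f ξ‖ₑ ≤ ∫⁻ x, ‖f x‖ₑ := by
  rw [Real.fourier_eq]
  refine (enorm_integral_le_lintegral_enorm _).trans (le_of_eq ?_)
  simp only [Circle.enorm_smul]

theorem continuous_fourier {f : V → ℂ} (hf : Integrable f) : Continuous (𝓕 f) :=
  VectorFourier.fourierIntegral_continuous Real.continuous_fourierChar
    (by exact continuous_inner) hf

theorem fourier_sub_apply {f g : V → ℂ} (hf : Integrable f) (hg : Integrable g) (ξ : V) :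
    𝓕 (fun x => f x - g x) ξ = 𝓕 f ξ - 𝓕 g ξ := by
  simp only [Real.fourier_eq, smul_sub]
  exact integral_sub ((Real.fourierIntegral_convergent_iff ξ).2 hf)
    ((Real.fourierIntegral_convergent_iff ξ).2 hg)

/-- Modulation changes neither `|f|` nor the support, so any local estimate holds for all translates
of the transform as well. -/
theorem fourier_sub_shift (f : V → ℂ) (ξ t : V) :
    𝓕 f (ξ - t) = 𝓕 (fun x => 𝐞 (inner ℝ x t) • f x) ξ := by
  simp only [Real.fourier_eq]
  congr 1; ext x
  rw [smul_smul, ← AddChar.map_add_eq_mul, inner_sub_right]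
  congr 2; ring

/-- An `L^p` function supported in a ball is integrable, with a quantitative bound. -/
theorem lintegral_enorm_le_of_support_subset {f : V → ℂ} {p : ℝ} (hp : 1 ≤ p)
    (hf : AEStronglyMeasurable f) {s : Set V} (hs : Function.support f ⊆ s) :
    ∫⁻ x, ‖f x‖ₑ ≤ eLpNorm f (ENNReal.ofReal p) volume * volume s ^ (1 - 1 / p) := by
  have h1 : eLpNorm f 1 (volume.restrict s) = ∫⁻ x, ‖f x‖ₑ := by
    rw [eLpNorm_restrict_eq_of_support_subset hs, eLpNorm_one_eq_lintegral_enorm]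
  rw [← h1, ← eLpNorm_restrict_eq_of_support_subset hs (p := ENNReal.ofReal p)]
  refine (eLpNorm_le_eLpNorm_mul_rpow_measure_univ (ENNReal.one_le_ofReal.2 hp)
    hf.restrict).trans (le_of_eq ?_)
  simp [ENNReal.toReal_ofReal (zero_le_one.trans hp)]

theorem integrable_of_support_subset {f : V → ℂ} {p : ℝ} (hp : 1 ≤ p)
    (hf : MemLp f (ENNReal.ofReal p)) {s : Set V} (hs : Function.support f ⊆ s)
    (hsv : volume s ≠ ⊤) : Integrable f := by
  refine ⟨hf.1, (lintegral_enorm_le_of_support_subset hp hf.1 hs).trans_lt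
    (ENNReal.mul_lt_top hf.2 (ENNReal.rpow_lt_top_of_nonneg ?_ hsv))⟩
  rw [sub_nonneg, div_le_one (zero_lt_one.trans_le hp)]
  exact hp

/-- A local restriction estimate for smooth functions extends to all `L^p` functions supported in
a ball. -/
theorem eLpNorm_fourier_le_of_smooth {σ : Measure V} [IsFiniteMeasure σ] {p q α A : ℝ}
    (hp : 1 ≤ p) (hq : 1 ≤ q)
    (h : ∀ R : ℝ, 1 ≤ R → ∀ (c : V) (f : V → ℂ), ContDiff ℝ ∞ f → tsupport f ⊆ Metric.ball c R →
      eLpNorm (𝓕 f) (ENNReal.ofReal q) σ ≤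
        ENNReal.ofReal (A * R ^ α) *
          eLpNorm f (ENNReal.ofReal p) (volume.restrict (Metric.ball c R)))
    {R : ℝ} (hR : 1 ≤ R) (c : V) {f : V → ℂ} (hf : MemLp f (ENNReal.ofReal p))
    (hfs : Function.support f ⊆ Metric.closedBall c R) :
    eLpNorm (𝓕 f) (ENNReal.ofReal q) σ ≤
      ENNReal.ofReal (A * (2 * R) ^ α) * eLpNorm f (ENNReal.ofReal p) volume := by
  have hR0 : 0 < R := by linarith
  have hp1 : 1 ≤ ENNReal.ofReal p := ENNReal.one_le_ofReal.2 hp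
  have hq1 : 1 ≤ ENNReal.ofReal q := ENNReal.one_le_ofReal.2 hq
  set B := Metric.ball c (2 * R) with hB
  have hBv : volume B ≠ ⊤ := measure_ball_lt_top.ne
  have hsB : Metric.closedBall c R ⊆ B := Metric.closedBall_subset_ball (by linarith)
  have hp' : 0 ≤ 1 - 1 / p := by
    rw [sub_nonneg, div_le_one (zero_lt_one.trans_le hp)]; exact hp
  set K := ENNReal.ofReal (A * (2 * R) ^ α)
  set K' := volume B ^ (1 - 1 / p) * σ Set.univ ^ (1 / q)
  have hK' : K' ≠ ⊤ := ENNReal.mul_ne_top (ENNReal.rpow_ne_top_of_nonneg hp' hBv)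
    (ENNReal.rpow_ne_top_of_nonneg (by positivity) (measure_ne_top _ _))
  -- The cutoff is 1 on the ball carrying `f` and has closed support in the open ball of radius
  -- `2R`; this enlargement is the source of `(2 * R) ^ α`.
  let η : ContDiffBump c := ⟨R, 3 / 2 * R, hR0, by linarith⟩
  have key : ∀ ε : ℝ, 0 < ε → eLpNorm (𝓕 f) (ENNReal.ofReal q) σ ≤
      K * (eLpNorm f (ENNReal.ofReal p) volume + ENNReal.ofReal ε) +
        ENNReal.ofReal ε * K' := by
    intro ε hε
    obtain ⟨g, hgc, hgs, hg⟩ := hf.exist_eLpNorm_sub_le ENNReal.ofReal_ne_top hp1 hε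
    set u : V → ℂ := fun x => (η x : ℂ) * g x with hu
    have hus : ContDiff ℝ ∞ u := (Complex.ofRealCLM.contDiff.comp η.contDiff).mul hgs
    have htη : tsupport η ⊆ B := by
      rw [η.tsupport_eq]; exact Metric.closedBall_subset_ball (by change 3 / 2 * R < _; linarith)
    have hut : tsupport u ⊆ B := by
      refine (closure_mono fun x hx => ?_).trans htη
      rw [Function.mem_support] at hx ⊢
      intro h0; exact hx (by simp [hu, h0])
    have huB : Function.support u ⊆ B := (subset_tsupport _).trans hut
    -- Since `f = η f`, cutting off the approximant `g` does not increase the `L^p` error. That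
    -- error contributes to the transform at most its `L^1` norm, which vanishes with `ε` for fixed
    -- `R`.
    have hfu : ∀ x, f x - u x = η x * (f x - g x) := by
      intro x
      by_cases hx : x ∈ Metric.closedBall c R
      · simp [hu, η.one_of_mem_closedBall hx]
      · have : f x = 0 := by by_contra h0; exact hx (hfs h0)
        simp [hu, this]
    have hle : ∀ x, ‖f x - u x‖ ≤ ‖f x - g x‖ := by
      intro x
      rw [hfu, norm_mul, Complex.norm_real, Real.norm_of_nonneg η.nonneg]
      exact mul_le_of_le_one_left (norm_nonneg _) η.le_one
    have hd : eLpNorm (fun x => f x - u x) (ENNReal.ofReal p) volume ≤ ENNReal.ofReal ε :=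
      (eLpNorm_mono hle).trans hg
    have hdm : AEStronglyMeasurable (fun x => f x - u x) :=
      hf.1.sub hus.continuous.aestronglyMeasurable
    have hdL : MemLp (fun x => f x - u x) (ENNReal.ofReal p) :=
      ⟨hdm, hd.trans_lt ENNReal.ofReal_lt_top⟩
    have hds : Function.support (fun x => f x - u x) ⊆ B := by
      refine (Function.support_sub f u).trans (Set.union_subset (hfs.trans hsB) huB)
    have hui : Integrable u :=
      hus.continuous.integrable_of_hasCompactSupport
        (HasCompactSupport.of_support_subset_isCompact (isCompact_closedBall c (2 * R))
          (huB.trans Metric.ball_subset_closedBall))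
    have hdi := integrable_of_support_subset hp hdL hds hBv
    have hfi := integrable_of_support_subset hp hf (hfs.trans hsB) hBv
    have hF : 𝓕 f = 𝓕 u + 𝓕 (fun x => f x - u x) := by
      ext ξ; rw [Pi.add_apply, fourier_sub_apply hfi hui]; ring
    rw [hF]
    refine (eLpNorm_add_le (continuous_fourier hui).aestronglyMeasurable
      (continuous_fourier hdi).aestronglyMeasurable hq1).trans (add_le_add ?_ ?_)
    · refine (h (2 * R) (by linarith) c u hus hut).trans ?_
      gcongr
      rw [eLpNorm_restrict_eq_of_support_subset huB]
      have : u = f - (fun x => f x - u x) := by ext x; simp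
      rw [this]
      exact (eLpNorm_sub_le hf.1 hdm hp1).trans (by gcongr)
    · refine (eLpNorm_le_of_enorm_le (by linarith) fun ξ =>
        (enorm_fourier_le_lintegral _ ξ).trans
          (lintegral_enorm_le_of_support_subset hp hdm hds)).trans ?_
      rw [mul_assoc]
      gcongr
  have hKt : K ≠ ⊤ := ENNReal.ofReal_ne_top
  have hlim : Filter.Tendsto (fun ε : ℝ => K * (eLpNorm f (ENNReal.ofReal p) volume +
      ENNReal.ofReal ε) + ENNReal.ofReal ε * K') (nhdsWithin 0 (Set.Ioi 0))
      (nhds (K * (eLpNorm f (ENNReal.ofReal p) volume + ENNReal.ofReal 0) +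
        ENNReal.ofReal 0 * K')) := by
    have h0 : Filter.Tendsto (fun ε : ℝ => ENNReal.ofReal ε) (nhdsWithin 0 (Set.Ioi 0))
      (nhds (ENNReal.ofReal 0)) :=
      (ENNReal.continuous_ofReal.tendsto 0).mono_left nhdsWithin_le_nhds
    exact (ENNReal.Tendsto.const_mul (h0.const_add _) (Or.inr hKt)).add
      (ENNReal.Tendsto.mul_const h0 (Or.inr hK'))
  have := ge_of_tendsto hlim (Filter.eventually_of_mem self_mem_nhdsWithin fun ε hε => key ε hε)
  simpa using this

/-- The weak form of Fourier inversion used to localize: a Schwartz cutoff is a superposition of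
characters. -/
theorem enorm_integral_schwartz_smul_le (φ : SchwartzMap V ℂ) {ν : Measure V} [SigmaFinite ν]
    {G : V → ℂ} (hG : Integrable G ν) (r : ℝ) (c : V) :
    ‖∫ x, φ (r • (x - c)) * G x ∂ν‖ₑ ≤
      ∫⁻ η, ‖𝓕 φ η‖ₑ * ‖∫ x, 𝐞 (inner ℝ x (r • η)) • G x ∂ν‖ₑ := by
  have hinv : ∀ y, φ y = ∫ η, 𝐞 (inner ℝ η y) • 𝓕 φ η := by
    intro y
    have h1 : 𝓕⁻ (𝓕 φ) = φ := FourierTransform.fourierInv_fourier_eq φ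
    conv_lhs => rw [← h1]
    rw [SchwartzMap.fourierInv_coe, Real.fourierInv_eq]
  set ψ : V → ℂ := fun η => 𝐞 (-inner ℝ η (r • c)) • 𝓕 φ η with hψ
  have hψi : Integrable ψ := by
    have := (Real.fourierIntegral_convergent_iff (μ := volume) (f := fun η => 𝓕 φ η) (r • c)).2
      (𝓕 φ).integrable
    exact this
  -- The kernel of `VectorFourier.fourierIntegral` is `𝐞 (-L η x)`, so the factor `-r` produces the
  -- character `𝐞 (r⟨η, x⟩)`; the centre `c` is absorbed into the phase of `ψ`. Fubini is then the
  -- flip identity.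
  set L : V →ₗ[ℝ] V →ₗ[ℝ] ℝ := (-r) • innerₗ V with hL
  have hLc : Continuous fun p : V × V => L p.1 p.2 := by
    simp only [hL, LinearMap.smul_apply, innerₗ_apply_apply, smul_eq_mul]
    fun_prop
  have hflip := VectorFourier.integral_fourierIntegral_smul_eq_flip (e := 𝐞) (L := L)
    Real.continuous_fourierChar hLc hψi hG
  have h1 : ∀ x, VectorFourier.fourierIntegral 𝐞 volume L ψ x = φ (r • (x - c)) := by
    intro x
    rw [hinv, VectorFourier.fourierIntegral]
    congr 1; ext η
    rw [hψ, smul_smul, ← AddChar.map_add_eq_mul]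
    congr 2
    simp [hL, inner_smul_right, inner_sub_right]; ring
  have h2 : ∀ η, VectorFourier.fourierIntegral 𝐞 ν L.flip G η =
      ∫ x, 𝐞 (inner ℝ x (r • η)) • G x ∂ν := by
    intro η
    rw [VectorFourier.fourierIntegral]
    congr 1; ext x
    congr 2
    simp [hL, inner_smul_right, real_inner_comm]
  simp only [h1, h2, smul_eq_mul] at hflip
  rw [hflip]
  refine (enorm_integral_le_lintegral_enorm _).trans (le_of_eq ?_)
  simp only [hψ, enorm_mul, Circle.enorm_smul]

end FourierEstimates

/-! ### Local constancy of `f^` at the scale inverse to the support of `f`. -/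

section LocalConstancy

variable {V : Type*} [NormedAddCommGroup V] [InnerProductSpace ℝ V] [FiniteDimensional ℝ V]
  [MeasurableSpace V] [BorelSpace V]

theorem SchwartzMap.exists_norm_le_one_add_norm_rpow (φ : SchwartzMap V ℂ) (k : ℕ) :
    ∃ C : ℝ, 0 ≤ C ∧ ∀ x, ‖φ x‖ ≤ C * (1 + ‖x‖) ^ (-(k : ℝ)) := by
  refine ⟨2 ^ k * (Finset.Iic (k, 0)).sup (fun m => SchwartzMap.seminorm ℝ m.1 m.2) φ,
    by positivity, fun x => ?_⟩
  have h := SchwartzMap.one_add_le_sup_seminorm_apply (𝕜 := ℝ) (m := (k, 0)) le_rfl le_rfl φ x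
  rw [norm_iteratedFDeriv_zero] at h
  have hx : 0 < (1 + ‖x‖) ^ k := by positivity
  rw [Real.rpow_neg (by positivity), Real.rpow_natCast, ← div_eq_mul_inv, le_div_iff₀ hx]
  linarith

theorem SchwartzMap.integrable_one_add_norm_rpow_mul (φ : SchwartzMap V ℂ) (ρ : ℝ) :
    Integrable (fun x => (1 + ‖x‖) ^ ρ * ‖φ x‖) := by
  obtain ⟨k, hk⟩ := exists_nat_gt (ρ + Module.finrank ℝ V)
  obtain ⟨C, -, hC⟩ := φ.exists_norm_le_one_add_norm_rpow k
  have hi : Integrable (fun x : V => (1 + ‖x‖) ^ (-((k : ℝ) - ρ))) :=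
    integrable_one_add_norm (by linarith)
  refine (hi.const_mul C).mono' ?_ (Filter.Eventually.of_forall fun x => ?_)
  · refine (Continuous.mul ?_ φ.continuous.norm).aestronglyMeasurable
    exact Continuous.rpow_const (by fun_prop) fun x => Or.inl (by positivity)
  · rw [Real.norm_of_nonneg (by positivity)]
    have hx : 0 < 1 + ‖x‖ := by positivity
    calc _ ≤ (1 + ‖x‖) ^ ρ * (C * (1 + ‖x‖) ^ (-(k : ℝ))) := by gcongr; exact hC x
      _ = C * ((1 + ‖x‖) ^ ρ * (1 + ‖x‖) ^ (-(k : ℝ))) := by ring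
      _ = _ := by rw [← Real.rpow_add hx]; congr 2; ring

/-- A smooth bump function as a complex Schwartz function. -/
noncomputable def ContDiffBump.toSchwartz (η : ContDiffBump (0 : V)) : SchwartzMap V ℂ :=
  (η.hasCompactSupport.comp_left (g := ((↑) : ℝ → ℂ)) Complex.ofReal_zero).toSchwartzMap
    (Complex.ofRealCLM.contDiff.comp η.contDiff)

theorem ContDiffBump.toSchwartz_apply (η : ContDiffBump (0 : V)) (x : V) :
    η.toSchwartz x = (η x : ℂ) := rfl

/-- The Fourier transform of a function supported in a ball of radius `R` is essentially constant
at scale `R⁻¹`. -/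
theorem exists_weight_enorm_fourier_le :
    ∃ W : V → ℝ≥0∞, Measurable W ∧ ∫⁻ η, W η ≠ ⊤ ∧
      ∀ R : ℝ, 0 < R → ∀ (c : V) (f : V → ℂ), Integrable f →
        Function.support f ⊆ Metric.closedBall c R → ∀ v ξ : V, ‖R • (ξ - v)‖ ≤ 1 →
          ‖𝓕 f ξ‖ₑ ≤ ∫⁻ η, W η * ‖𝓕 f (v - R⁻¹ • η)‖ₑ := by
  let b : ContDiffBump (0 : V) := ⟨1, 2, one_pos, one_lt_two⟩
  set φ := b.toSchwartz with hφ
  obtain ⟨k, hk⟩ := exists_nat_gt (Module.finrank ℝ V : ℝ)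
  obtain ⟨C, hC0, hC⟩ := (𝓕 φ).exists_norm_le_one_add_norm_rpow k
  refine ⟨fun η => ENNReal.ofReal (C * 2 ^ (k : ℝ) * (1 + ‖η‖) ^ (-(k : ℝ))), by fun_prop, ?_, ?_⟩
  · have := ((integrable_one_add_norm (μ := (volume : Measure V)) hk).const_mul
      (C * 2 ^ (k : ℝ))).lintegral_lt_top
    exact this.ne
  intro R hR c f hf hfs v ξ hξ
  have hG : Integrable (fun x => 𝐞 (-inner ℝ x ξ) • f x) :=
    (Real.fourierIntegral_convergent_iff ξ).2 hf
  have h1 := enorm_integral_schwartz_smul_le φ hG R⁻¹ c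
  have h2 : ∫ x, φ (R⁻¹ • (x - c)) * (𝐞 (-inner ℝ x ξ) • f x) = 𝓕 f ξ := by
    rw [Real.fourier_eq]
    congr 1; ext x
    by_cases hx : x ∈ Metric.closedBall c R
    · rw [hφ, b.toSchwartz_apply, b.one_of_mem_closedBall, Complex.ofReal_one, one_mul]
      rw [mem_closedBall_zero_iff, norm_smul, norm_inv, Real.norm_of_nonneg hR.le, ← dist_eq_norm,
        inv_mul_le_iff₀ hR]
      simpa [b] using hx
    · have : f x = 0 := by by_contra h0; exact hx (hfs h0)
      simp [this]
  rw [h2] at h1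
  refine h1.trans ?_
  have h3 : ∀ η, ∫ x, 𝐞 (inner ℝ x (R⁻¹ • η)) • 𝐞 (-inner ℝ x ξ) • f x = 𝓕 f (ξ - R⁻¹ • η) := by
    intro η
    rw [Real.fourier_eq]
    congr 1; ext x
    rw [smul_smul, ← AddChar.map_add_eq_mul, inner_sub_right]
    congr 2; ring
  simp_rw [h3]
  -- Translating the variable replaces the base point `ξ` by `v`. The translation has length at most
  -- 1, so the polynomial majorant of `𝓕 φ` changes by at most `2 ^ k`; `k` exceeds the dimension to
  -- keep it integrable.
  rw [← lintegral_add_right_eq_self _ (R • (ξ - v))]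
  refine lintegral_mono fun η => ?_
  have h4 : ξ - R⁻¹ • (η + R • (ξ - v)) = v - R⁻¹ • η := by
    rw [smul_add, inv_smul_smul₀ hR.ne']; abel
  rw [h4]
  gcongr
  rw [← ofReal_norm]
  refine ENNReal.ofReal_le_ofReal ((hC _).trans ?_)
  rw [mul_assoc]
  gcongr
  set t := R • (ξ - v)
  have h5 : 1 + ‖η‖ ≤ 2 * (1 + ‖η + t‖) := by
    have : ‖η‖ ≤ ‖η + t‖ + ‖t‖ := by simpa using norm_sub_le (η + t) t
    linarith [norm_nonneg (η + t)]
  have ha : 0 < 1 + ‖η‖ := by positivity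
  have hb : 0 < 1 + ‖η + t‖ := by positivity
  rw [Real.rpow_neg ha.le, Real.rpow_neg hb.le, ← div_eq_mul_inv, inv_eq_one_div,
    div_le_div_iff₀ (by positivity) (by positivity), one_mul, ← Real.mul_rpow (by norm_num) hb.le]
  exact Real.rpow_le_rpow ha.le h5 (by positivity)

/-- Jensen's inequality for the unnormalised weight `W`, obtained from Hölder by writing `W h =
W^{1-1/q} (W h^q)^{1/q}`. -/
theorem lintegral_mul_rpow_le_of_one_le {α : Type*} [MeasurableSpace α] {μ : Measure α}
    {W h : α → ℝ≥0∞} (hW : Measurable W) (hh : Measurable h) {q : ℝ} (hq : 1 ≤ q) :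
    (∫⁻ x, W x * h x ∂μ) ^ q ≤ (∫⁻ x, W x ∂μ) ^ (q - 1) * ∫⁻ x, W x * h x ^ q ∂μ := by
  have hq0 : 0 < q := by linarith
  have h1 := ENNReal.lintegral_mul_norm_pow_le (μ := μ) hW.aemeasurable
    (hW.mul (hh.pow_const q)).aemeasurable (p := 1 - 1 / q) (q := 1 / q)
    (by rw [sub_nonneg, div_le_one hq0]; exact hq) (by positivity) (by ring)
  have h2 : ∀ x, W x ^ (1 - 1 / q) * (W x * h x ^ q) ^ (1 / q) = W x * h x := by
    intro x
    rw [ENNReal.mul_rpow_of_nonneg _ _ (by positivity), ← ENNReal.rpow_mul,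
      mul_one_div_cancel hq0.ne', ENNReal.rpow_one, ← mul_assoc,
      ← ENNReal.rpow_add_of_nonneg _ _ (by rw [sub_nonneg, div_le_one hq0]; exact hq)
        (by positivity), sub_add_cancel, ENNReal.rpow_one]
  simp only [Pi.mul_apply, h2] at h1
  calc _ ≤ _ := ENNReal.rpow_le_rpow h1 hq0.le
    _ = _ := by
      rw [ENNReal.mul_rpow_of_nonneg _ _ hq0.le, ← ENNReal.rpow_mul, ← ENNReal.rpow_mul,
        one_div_mul_cancel hq0.ne', ENNReal.rpow_one]
      congr 2
      field_simp

end LocalConstancy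

/-! ### Fourier decay of localized measures and almost orthogonality in `L^2`. -/

section AlmostOrthogonality

variable {V : Type*} [NormedAddCommGroup V] [InnerProductSpace ℝ V] [FiniteDimensional ℝ V]
  [MeasurableSpace V] [BorelSpace V]

/-- Peetre's inequality `1 + |z| ≤ (1 + |z - Rη|) R (1 + |η|)`; the growth in `η` will be integrated
against a Schwartz function. -/
theorem one_add_norm_sub_rpow_le {ρ : ℝ} (hρ : 0 ≤ ρ) {R : ℝ} (hR : 1 ≤ R) (z η : V) :
    (1 + ‖z - R • η‖) ^ (-ρ) ≤ R ^ ρ * (1 + ‖η‖) ^ ρ * (1 + ‖z‖) ^ (-ρ) := by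
  have hz : 0 < 1 + ‖z‖ := by positivity
  have hb : 0 < 1 + ‖z - R • η‖ := by positivity
  have hη : 0 < 1 + ‖η‖ := by positivity
  have hR0 : 0 < R := by linarith
  have h1 : 1 + ‖z‖ ≤ (1 + ‖z - R • η‖) * (R * (1 + ‖η‖)) := by
    have h2 : ‖z‖ ≤ ‖z - R • η‖ + R * ‖η‖ := by
      have := norm_add_le (z - R • η) (R • η)
      rwa [sub_add_cancel, norm_smul, Real.norm_of_nonneg hR0.le] at this
    nlinarith [norm_nonneg (z - R • η), norm_nonneg η,
      mul_nonneg (norm_nonneg (z - R • η)) (norm_nonneg η),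
      mul_nonneg (norm_nonneg (z - R • η)) (mul_nonneg hR0.le (norm_nonneg η)),
      mul_nonneg (norm_nonneg (z - R • η)) (sub_nonneg.2 hR)]
  have h3 := Real.rpow_le_rpow hz.le h1 hρ
  rw [Real.mul_rpow hb.le (by positivity), Real.mul_rpow hR0.le hη.le] at h3
  rw [Real.rpow_neg hz.le, Real.rpow_neg hb.le, ← div_eq_mul_inv, inv_eq_one_div,
    div_le_div_iff₀ (by positivity) (by positivity), one_mul]
  linarith

/-- Multiplying a measure with Fourier decay by a bump at scale `R⁻¹` costs at most `R^ρ`. -/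
theorem exists_norm_integral_schwartz_smul_le {σ : Measure V} [IsFiniteMeasure σ] {ρ A : ℝ}
    (hρ : 0 ≤ ρ)
    (hdec : ∀ z : V, ‖∫ ξ, (𝐞 (-inner ℝ ξ z) : ℂ) ∂σ‖ ≤ A * (1 + ‖z‖) ^ (-ρ))
    (φ : SchwartzMap V ℂ) :
    ∃ C : ℝ, 0 ≤ C ∧ ∀ R : ℝ, 1 ≤ R → ∀ v z : V,
      ‖∫ ξ, φ (R • (ξ - v)) * (𝐞 (-inner ℝ ξ z) : ℂ) ∂σ‖ ≤ C * R ^ ρ * (1 + ‖z‖) ^ (-ρ) := by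
  have hA : 0 ≤ A := by
    have := (norm_nonneg _).trans (hdec 0)
    simpa using this
  set I := ∫ η, (1 + ‖η‖) ^ ρ * ‖𝓕 φ η‖ with hI
  have hI0 : 0 ≤ I := integral_nonneg fun η => by positivity
  refine ⟨A * I, by positivity, fun R hR v z => ?_⟩
  have hR0 : 0 < R := by linarith
  have hGi : Integrable (fun ξ : V => (𝐞 (-inner ℝ ξ z) : ℂ)) σ := by
    refine Integrable.of_bound (C := 1) (Continuous.aestronglyMeasurable ?_)
      (Filter.Eventually.of_forall fun ξ => (Circle.norm_coe _).le)
    have := Real.continuous_fourierChar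
    fun_prop
  have h1 := enorm_integral_schwartz_smul_le φ hGi R v
  have h2 : ∀ η, ∫ ξ, 𝐞 (inner ℝ ξ (R • η)) • (𝐞 (-inner ℝ ξ z) : ℂ) ∂σ =
      ∫ ξ, (𝐞 (-inner ℝ ξ (z - R • η)) : ℂ) ∂σ := by
    intro η
    congr 1; ext ξ
    rw [Circle.smul_def, smul_eq_mul, ← Circle.coe_mul, ← AddChar.map_add_eq_mul, inner_sub_right]
    congr 2; ring
  simp_rw [h2] at h1
  have hnn : 0 ≤ A * I * R ^ ρ * (1 + ‖z‖) ^ (-ρ) := by positivity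
  rw [← ENNReal.ofReal_le_ofReal_iff hnn, ofReal_norm]
  refine h1.trans ?_
  calc _ ≤ ∫⁻ η, ENNReal.ofReal (A * R ^ ρ * (1 + ‖z‖) ^ (-ρ) * ((1 + ‖η‖) ^ ρ * ‖𝓕 φ η‖)) := by
        refine lintegral_mono fun η => ?_
        rw [← ofReal_norm, ← ofReal_norm, ← ENNReal.ofReal_mul (norm_nonneg _)]
        refine ENNReal.ofReal_le_ofReal ?_
        calc _ ≤ ‖𝓕 φ η‖ * (A * (R ^ ρ * (1 + ‖η‖) ^ ρ * (1 + ‖z‖) ^ (-ρ))) := by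
              gcongr
              exact (hdec _).trans (by gcongr; exact one_add_norm_sub_rpow_le hρ hR z η)
          _ = _ := by ring
    _ = _ := by
        rw [← ofReal_integral_eq_lintegral_ofReal
          (((𝓕 φ).integrable_one_add_norm_rpow_mul ρ).const_mul _)
          (Filter.Eventually.of_forall fun η => by positivity), integral_const_mul]
        congr 1; ring

open ComplexConjugate in
theorem conj_fourier (f : V → ℂ) (ξ : V) :
    conj (𝓕 f ξ) = VectorFourier.fourierIntegral 𝐞 volume (-innerₗ V) (fun y => conj (f y)) ξ := by
  rw [Real.fourier_eq, ← integral_conj, VectorFourier.fourierIntegral]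
  congr 1; ext y
  simp only [Circle.smul_def, smul_eq_mul, map_mul, ← Circle.coe_inv_eq_conj,
    ← AddChar.map_neg_eq_inv]
  simp

-- Two applications of Fubini turn the left side into a double integral of `f(x) conj(g(y))` against
-- the transform of `w dσ` at `x - y`, so only differences of points of the two supports matter.
open ComplexConjugate in
theorem norm_integral_fourier_mul_conj_fourier_le {σ : Measure V} [IsFiniteMeasure σ]
    {w : V → ℂ} (hw : Continuous w) {M : ℝ} (hM : ∀ ξ, ‖w ξ‖ ≤ M) {f g : V → ℂ}
    (hf : Integrable f) (hg : Integrable g) {κ : ℝ}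
    (hκ : ∀ x ∈ Function.support f, ∀ y ∈ Function.support g,
      ‖∫ ξ, w ξ * (𝐞 (-inner ℝ ξ (x - y)) : ℂ) ∂σ‖ ≤ κ) :
    ‖∫ ξ, w ξ * (𝓕 f ξ * conj (𝓕 g ξ)) ∂σ‖ ≤ κ * (∫ x, ‖f x‖) * ∫ y, ‖g y‖ := by
  have he := Real.continuous_fourierChar
  have hgF := continuous_fourier hg
  have hgb : ∀ ξ, ‖𝓕 g ξ‖ ≤ ∫ y, ‖g y‖ := fun ξ =>
    VectorFourier.norm_fourierIntegral_le_integral_norm _ _ _ _ _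
  have hM0 : 0 ≤ M := (norm_nonneg _).trans (hM 0)
  have hGi : Integrable (fun ξ => w ξ * conj (𝓕 g ξ)) σ := by
    refine Integrable.of_bound (C := M * ∫ y, ‖g y‖)
      (hw.mul (Complex.continuous_conj.comp hgF)).aestronglyMeasurable
      (Filter.Eventually.of_forall fun ξ => ?_)
    rw [norm_mul, RCLike.norm_conj]
    exact mul_le_mul (hM _) (hgb _) (norm_nonneg _) hM0
  have hflip := VectorFourier.integral_fourierIntegral_smul_eq_flip (e := 𝐞) (L := innerₗ V)
    he (by exact continuous_inner) hf hGi
  have h1 : ∫ ξ, w ξ * (𝓕 f ξ * conj (𝓕 g ξ)) ∂σ =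
      ∫ x, f x • VectorFourier.fourierIntegral 𝐞 σ (innerₗ V).flip
        (fun ξ => w ξ * conj (𝓕 g ξ)) x := by
    rw [← hflip]
    congr 1; ext ξ
    change _ = 𝓕 f ξ • _
    rw [smul_eq_mul]; ring
  have h2 : ∀ x ∈ Function.support f, ‖VectorFourier.fourierIntegral 𝐞 σ (innerₗ V).flip
      (fun ξ => w ξ * conj (𝓕 g ξ)) x‖ ≤ κ * ∫ y, ‖g y‖ := by
    intro x hx
    have hwi : Integrable (fun ξ => w ξ * (𝐞 (-inner ℝ ξ x) : ℂ)) σ := by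
      refine Integrable.of_bound (C := M) (Continuous.aestronglyMeasurable (by fun_prop))
        (Filter.Eventually.of_forall fun ξ => ?_)
      rw [norm_mul, Circle.norm_coe, mul_one]
      exact hM ξ
    have hLc : Continuous fun p : V × V => (-innerₗ V : V →ₗ[ℝ] V →ₗ[ℝ] ℝ) p.1 p.2 := by
      simp only [LinearMap.neg_apply, innerₗ_apply_apply]
      fun_prop
    have hci : Integrable fun y => conj (g y) :=
      (Complex.conjLIE.integrable_comp_iff).2 hg
    have hflip2 := VectorFourier.integral_fourierIntegral_smul_eq_flip (e := 𝐞)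
      (L := -innerₗ V) he hLc hci hwi
    have h3 : VectorFourier.fourierIntegral 𝐞 σ (innerₗ V).flip
        (fun ξ => w ξ * conj (𝓕 g ξ)) x = ∫ y, conj (g y) • VectorFourier.fourierIntegral 𝐞 σ
          (-innerₗ V).flip (fun ξ => w ξ * (𝐞 (-inner ℝ ξ x) : ℂ)) y := by
      rw [← hflip2, VectorFourier.fourierIntegral]
      congr 1; ext ξ
      rw [← conj_fourier, Circle.smul_def]
      simp only [smul_eq_mul, LinearMap.flip_apply, innerₗ_apply_apply, real_inner_comm ξ x]
      ring
    rw [h3, ← integral_const_mul]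
    refine norm_integral_le_of_norm_le (hg.norm.const_mul κ) (Filter.Eventually.of_forall fun y => ?_)
    by_cases hy : y ∈ Function.support g
    · rw [norm_smul, RCLike.norm_conj, mul_comm]
      gcongr
      refine le_trans (le_of_eq ?_) (hκ x hx y hy)
      rw [VectorFourier.fourierIntegral]
      congr 2; ext ξ
      rw [Circle.smul_def, smul_eq_mul, mul_left_comm, ← Circle.coe_mul,
        ← AddChar.map_add_eq_mul]
      congr 3
      simp [inner_sub_right, real_inner_comm ξ y]
      ring
    · have : g y = 0 := by simpa using hy
      simp [this]
  rw [h1]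
  calc _ ≤ ∫ x, κ * (∫ y, ‖g y‖) * ‖f x‖ := by
        refine norm_integral_le_of_norm_le (hf.norm.const_mul _)
          (Filter.Eventually.of_forall fun x => ?_)
        by_cases hx : x ∈ Function.support f
        · rw [norm_smul, mul_comm]
          gcongr
          exact h2 x hx
        · have : f x = 0 := by simpa using hx
          simp [this]
    _ = _ := by rw [integral_const_mul]; ring

-- The square is expanded: diagonal terms are kept, and each of the at most `card ^ 2` off-diagonal
-- terms is bounded by `κ`.
open ComplexConjugate in
theorem lintegral_mul_enorm_sum_sq_le {α ι : Type*} [TopologicalSpace α] [MeasurableSpace α]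
    [BorelSpace α] {σ : Measure α} [IsFiniteMeasure σ]
    [DecidableEq ι] (s : Finset ι) {w : α → ℝ} (hw : Continuous w) (hw0 : ∀ ξ, 0 ≤ w ξ) {M : ℝ}
    (hM : ∀ ξ, w ξ ≤ M) {a : ι → α → ℂ} (ha : ∀ i ∈ s, Continuous (a i)) {b : ℝ}
    (hb : ∀ i ∈ s, ∀ ξ, ‖a i ξ‖ ≤ b) {κ : ℝ} (hκ0 : 0 ≤ κ)
    (hκ : ∀ i ∈ s, ∀ j ∈ s, i ≠ j → ‖∫ ξ, (w ξ : ℂ) * (a i ξ * conj (a j ξ)) ∂σ‖ ≤ κ) :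
    ∫⁻ ξ, ENNReal.ofReal (w ξ) * ‖∑ i ∈ s, a i ξ‖ₑ ^ 2 ∂σ ≤
      ∑ i ∈ s, ∫⁻ ξ, ENNReal.ofReal (w ξ) * ‖a i ξ‖ₑ ^ 2 ∂σ + ENNReal.ofReal (s.card ^ 2 * κ) := by
  have hconv : ∀ h : α → ℂ, ∀ ξ, ENNReal.ofReal (w ξ) * ‖h ξ‖ₑ ^ 2 =
      ENNReal.ofReal (w ξ * ‖h ξ‖ ^ 2) := by
    intro h ξ
    rw [ENNReal.ofReal_mul (hw0 ξ), ENNReal.ofReal_pow (norm_nonneg _), ofReal_norm]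
  have hint : ∀ i ∈ s, ∀ j ∈ s, Integrable (fun ξ => (w ξ : ℂ) * (a i ξ * conj (a j ξ))) σ := by
    intro i hi j hj
    have h1 := ha i hi
    have h2 := ha j hj
    refine Integrable.of_bound (C := M * (b * b)) (Continuous.aestronglyMeasurable (by fun_prop))
      (Filter.Eventually.of_forall fun ξ => ?_)
    rw [norm_mul, norm_mul, RCLike.norm_conj, Complex.norm_real, Real.norm_of_nonneg (hw0 ξ)]
    have hb0 := (norm_nonneg _).trans (hb i hi ξ)
    exact mul_le_mul (hM ξ) (mul_le_mul (hb i hi ξ) (hb j hj ξ) (norm_nonneg _) hb0)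
      (by positivity) ((hw0 ξ).trans (hM ξ))
  have hdiag : ∀ i ξ, ((w ξ * ‖a i ξ‖ ^ 2 : ℝ) : ℂ) = (w ξ : ℂ) * (a i ξ * conj (a i ξ)) := by
    intro i ξ
    rw [Complex.mul_conj, Complex.normSq_eq_norm_sq]; push_cast; ring
  have hdint : ∀ i ∈ s, Integrable (fun ξ => w ξ * ‖a i ξ‖ ^ 2) σ := by
    intro i hi
    have := (hint i hi i hi).re
    refine this.congr (Filter.Eventually.of_forall fun ξ => ?_)
    change Complex.re _ = _
    rw [← hdiag, Complex.ofReal_re]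
  have hsq : ∀ ξ, ((w ξ * ‖∑ i ∈ s, a i ξ‖ ^ 2 : ℝ) : ℂ) =
      ∑ i ∈ s, ∑ j ∈ s, (w ξ : ℂ) * (a i ξ * conj (a j ξ)) := by
    intro ξ
    rw [Complex.ofReal_mul, Complex.ofReal_pow, ← Complex.mul_conj', map_sum,
      Finset.sum_mul_sum, Finset.mul_sum]
    simp_rw [Finset.mul_sum]
  have hsint : Integrable (fun ξ => w ξ * ‖∑ i ∈ s, a i ξ‖ ^ 2) σ := by
    have := (integrable_finsetSum s fun i hi => integrable_finsetSum s fun j hj =>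
      hint i hi j hj).re
    refine this.congr (Filter.Eventually.of_forall fun ξ => ?_)
    change Complex.re _ = _
    rw [← hsq, Complex.ofReal_re]
  rw [lintegral_congr (hconv fun ξ => ∑ i ∈ s, a i ξ)]
  simp_rw [hconv]
  rw [← ofReal_integral_eq_lintegral_ofReal (f := fun ξ => w ξ * ‖∑ i ∈ s, a i ξ‖ ^ 2) hsint
    (Filter.Eventually.of_forall fun ξ => mul_nonneg (hw0 ξ) (by positivity))]
  have hterm : ∀ i ∈ s, ∫⁻ ξ, ENNReal.ofReal (w ξ * ‖a i ξ‖ ^ 2) ∂σ =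
      ENNReal.ofReal (∫ ξ, w ξ * ‖a i ξ‖ ^ 2 ∂σ) := fun i hi =>
    (ofReal_integral_eq_lintegral_ofReal (hdint i hi)
      (Filter.Eventually.of_forall fun ξ => mul_nonneg (hw0 ξ) (by positivity))).symm
  have hnn : ∀ i ∈ s, 0 ≤ ∫ ξ, w ξ * ‖a i ξ‖ ^ 2 ∂σ := fun i hi =>
    integral_nonneg fun ξ => mul_nonneg (hw0 ξ) (by positivity)
  rw [Finset.sum_congr rfl hterm, ← ENNReal.ofReal_sum_of_nonneg hnn,
    ← ENNReal.ofReal_add (Finset.sum_nonneg hnn) (by positivity)]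
  refine ENNReal.ofReal_le_ofReal ?_
  have hexp : ((∫ ξ, w ξ * ‖∑ i ∈ s, a i ξ‖ ^ 2 ∂σ : ℝ) : ℂ) =
      ∑ i ∈ s, ∑ j ∈ s, ∫ ξ, (w ξ : ℂ) * (a i ξ * conj (a j ξ)) ∂σ := by
    rw [← integral_complex_ofReal]
    simp_rw [hsq]
    rw [integral_finsetSum s fun i hi => integrable_finsetSum s fun j hj => hint i hi j hj]
    exact Finset.sum_congr rfl fun i hi => integral_finsetSum s fun j hj => hint i hi j hj
  have hre : ∫ ξ, w ξ * ‖∑ i ∈ s, a i ξ‖ ^ 2 ∂σ =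
      ∑ i ∈ s, ∑ j ∈ s, (∫ ξ, (w ξ : ℂ) * (a i ξ * conj (a j ξ)) ∂σ).re := by
    have := congrArg Complex.re hexp
    simpa using this
  rw [hre]
  have hrow : ∀ i ∈ s, ∑ j ∈ s, (∫ ξ, (w ξ : ℂ) * (a i ξ * conj (a j ξ)) ∂σ).re ≤
      (∫ ξ, w ξ * ‖a i ξ‖ ^ 2 ∂σ) + s.card * κ := by
    intro i hi
    rw [← Finset.add_sum_erase s _ hi]
    refine add_le_add (le_of_eq ?_) ?_
    · have : ∫ ξ, (w ξ : ℂ) * (a i ξ * conj (a i ξ)) ∂σ =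
        ((∫ ξ, w ξ * ‖a i ξ‖ ^ 2 ∂σ : ℝ) : ℂ) := by
        rw [← integral_complex_ofReal]; simp_rw [hdiag]
      rw [this, Complex.ofReal_re]
    · calc _ ≤ ∑ _j ∈ s.erase i, κ := Finset.sum_le_sum fun j hj =>
            (Complex.re_le_norm _).trans (hκ i hi j (Finset.mem_of_mem_erase hj)
              (Finset.ne_of_mem_erase hj).symm)
        _ = ((s.erase i).card : ℝ) * κ := by simp
        _ ≤ _ := by gcongr; exact Finset.erase_subset _ _
  calc _ ≤ ∑ i ∈ s, ((∫ ξ, w ξ * ‖a i ξ‖ ^ 2 ∂σ) + s.card * κ) := Finset.sum_le_sum hrow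
    _ = _ := by rw [Finset.sum_add_distrib]; simp; ring

end AlmostOrthogonality

/-! ### From `L^2` orthogonality to `L^q` sums on one frequency ball. -/

theorem ENNReal.rpow_sum_le_sum_rpow {ι : Type*} (s : Finset ι) (f : ι → ℝ≥0∞) {θ : ℝ}
    (h0 : 0 < θ) (h1 : θ ≤ 1) : (∑ i ∈ s, f i) ^ θ ≤ ∑ i ∈ s, f i ^ θ := by
  classical
  induction s using Finset.induction_on with
  | empty => simp [h0]
  | insert a s ha ih =>
    rw [Finset.sum_insert ha, Finset.sum_insert ha]
    exact (ENNReal.rpow_add_le_add_rpow _ _ h0.le h1).trans (by gcongr)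

theorem ENNReal.sum_rpow_le_rpow_sum {ι : Type*} (s : Finset ι) (f : ι → ℝ≥0∞) {r : ℝ}
    (h1 : 1 ≤ r) : ∑ i ∈ s, f i ^ r ≤ (∑ i ∈ s, f i) ^ r := by
  have hr : 0 < r := by linarith
  have := ENNReal.rpow_sum_le_sum_rpow s (fun i => f i ^ r) (θ := 1 / r) (by positivity)
    (by rw [div_le_one hr]; exact h1)
  have h2 : ∀ i, (f i ^ r) ^ (1 / r) = f i := fun i => by
    rw [← ENNReal.rpow_mul, mul_one_div_cancel hr.ne', ENNReal.rpow_one]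
  simp_rw [h2] at this
  calc _ = ((∑ i ∈ s, f i ^ r) ^ (1 / r)) ^ r := by
        rw [← ENNReal.rpow_mul, one_div_mul_cancel hr.ne', ENNReal.rpow_one]
    _ ≤ _ := ENNReal.rpow_le_rpow this hr.le

-- Hölder with respect to `w dσ` costs `m^{1-q/2}`, where `m` is its mass. The pointwise bound `J i`
-- on the support of `w` gives `∫ w |a_i|^2 ≤ m J_i^{2/q}`; after raising to the power `q/2`, which
-- is subadditive, the powers of `m` recombine to exactly `m`. Hence no loss in passing through
-- `L^2`.
open ComplexConjugate in
theorem lintegral_mul_enorm_sum_rpow_le {α ι : Type*} [TopologicalSpace α] [MeasurableSpace α]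
    [BorelSpace α] {σ : Measure α} [IsFiniteMeasure σ]
    [DecidableEq ι] (s : Finset ι) {w : α → ℝ} (hw : Continuous w) (hw0 : ∀ ξ, 0 ≤ w ξ) {M : ℝ}
    (hM : ∀ ξ, w ξ ≤ M) {a : ι → α → ℂ} (ha : ∀ i ∈ s, Continuous (a i)) {b : ℝ}
    (hb : ∀ i ∈ s, ∀ ξ, ‖a i ξ‖ ≤ b) {κ : ℝ} (hκ0 : 0 ≤ κ)
    (hκ : ∀ i ∈ s, ∀ j ∈ s, i ≠ j → ‖∫ ξ, (w ξ : ℂ) * (a i ξ * conj (a j ξ)) ∂σ‖ ≤ κ)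
    {q : ℝ} (hq0 : 0 < q) (hq2 : q ≤ 2) {J : ι → ℝ≥0∞}
    (hJ : ∀ i ∈ s, ∀ ξ, w ξ ≠ 0 → ‖a i ξ‖ₑ ^ q ≤ J i) :
    ∫⁻ ξ, ENNReal.ofReal (w ξ) * ‖∑ i ∈ s, a i ξ‖ₑ ^ q ∂σ ≤
      (∫⁻ ξ, ENNReal.ofReal (w ξ) ∂σ) * ∑ i ∈ s, J i +
        (∫⁻ ξ, ENNReal.ofReal (w ξ) ∂σ) ^ (1 - q / 2) *
          ENNReal.ofReal (s.card ^ 2 * κ) ^ (q / 2) := by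
  set m := ∫⁻ ξ, ENNReal.ofReal (w ξ) ∂σ with hm
  have hsum : Continuous fun ξ => ∑ i ∈ s, a i ξ := continuous_finsetSum s ha
  have hwm : Measurable fun ξ => ENNReal.ofReal (w ξ) := hw.measurable.ennreal_ofReal
  have hsm : Measurable fun ξ => ‖∑ i ∈ s, a i ξ‖ₑ := hsum.measurable.enorm
  have hq1 : 0 ≤ 1 - q / 2 := by linarith
  have h1 := ENNReal.lintegral_mul_norm_pow_le (μ := σ) hwm.aemeasurable
    (hwm.mul (hsm.pow_const 2)).aemeasurable (p := 1 - q / 2) (q := q / 2) hq1 (by linarith)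
    (by ring)
  have h2 : ∀ ξ, ENNReal.ofReal (w ξ) ^ (1 - q / 2) *
      (ENNReal.ofReal (w ξ) * ‖∑ i ∈ s, a i ξ‖ₑ ^ 2) ^ (q / 2) =
      ENNReal.ofReal (w ξ) * ‖∑ i ∈ s, a i ξ‖ₑ ^ q := by
    intro ξ
    rw [ENNReal.mul_rpow_of_nonneg _ _ (by positivity), ← ENNReal.rpow_natCast_mul, ← mul_assoc,
      ← ENNReal.rpow_add_of_nonneg _ _ hq1 (by positivity), sub_add_cancel, ENNReal.rpow_one]
    congr 2
    push_cast; ring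
  simp only [Pi.mul_apply, h2] at h1
  refine h1.trans ?_
  have h3 := lintegral_mul_enorm_sum_sq_le s hw hw0 hM ha hb hκ0 hκ (σ := σ)
  have h4 : ∀ i ∈ s, ∫⁻ ξ, ENNReal.ofReal (w ξ) * ‖a i ξ‖ₑ ^ 2 ∂σ ≤ m * J i ^ (2 / q) := by
    intro i hi
    rw [hm, ← lintegral_mul_const _ hwm]
    refine lintegral_mono fun ξ => ?_
    by_cases h0 : w ξ = 0
    · simp [h0]
    · gcongr
      calc ‖a i ξ‖ₑ ^ 2 = (‖a i ξ‖ₑ ^ q) ^ (2 / q) := by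
            rw [← ENNReal.rpow_mul, mul_div_cancel₀ _ hq0.ne']; norm_cast
        _ ≤ _ := ENNReal.rpow_le_rpow (hJ i hi ξ h0) (by positivity)
  calc _ ≤ m ^ (1 - q / 2) * (∑ i ∈ s, m * J i ^ (2 / q) +
        ENNReal.ofReal (s.card ^ 2 * κ)) ^ (q / 2) := by
        gcongr
        exact h3.trans (by gcongr with i hi; exact h4 i hi)
    _ ≤ m ^ (1 - q / 2) * (m ^ (q / 2) * ∑ i ∈ s, J i +
        ENNReal.ofReal (s.card ^ 2 * κ) ^ (q / 2)) := by
        gcongr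
        refine (ENNReal.rpow_add_le_add_rpow _ _ (by positivity) (by linarith)).trans ?_
        gcongr
        rw [← Finset.mul_sum, ENNReal.mul_rpow_of_nonneg _ _ (by positivity)]
        gcongr
        refine (ENNReal.rpow_sum_le_sum_rpow _ _ (by positivity) (by linarith)).trans (le_of_eq ?_)
        refine Finset.sum_congr rfl fun i _ => ?_
        rw [← ENNReal.rpow_mul, div_mul_div_cancel₀ hq0.ne', div_self two_ne_zero,
          ENNReal.rpow_one]
    _ = _ := by
        rw [mul_add, ← mul_assoc, ← ENNReal.rpow_add_of_nonneg _ _ hq1 (by positivity),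
          sub_add_cancel, ENNReal.rpow_one]

/-! ### Averaging over all frequency balls of radius `1/R`. -/

section Scaling

variable {V : Type*} [NormedAddCommGroup V] [InnerProductSpace ℝ V] [FiniteDimensional ℝ V]
  [MeasurableSpace V] [BorelSpace V]

theorem lintegral_comp_smul_sub {g : V → ℝ≥0∞} (hg : Measurable g) {R : ℝ} (hR : 0 < R) (ξ : V) :
    ∫⁻ v, g (R • (ξ - v)) = ENNReal.ofReal (R ^ Module.finrank ℝ V)⁻¹ * ∫⁻ v, g v := by
  rw [lintegral_sub_left_eq_self (fun v => g (R • v)) ξ,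
    ← lintegral_map hg (measurable_const_smul R), Measure.map_addHaar_smul _ hR.ne',
    lintegral_smul_measure, abs_of_pos (by positivity), smul_eq_mul]

/-- If all translates of `h` have `σ`-integral at most `T`, then so have its averages against
translates of the weights `g` and `W`. -/
theorem lintegral_lintegral_average_le {σ : Measure V} [IsFiniteMeasure σ] {g W h : V → ℝ≥0∞}
    (hg : Measurable g) (hW : Measurable W) (hh : Measurable h) {T : ℝ≥0∞}
    (hT : ∀ t, ∫⁻ ξ, h (ξ - t) ∂σ ≤ T) {R : ℝ} (hR : 0 < R) :
    ∫⁻ v, (∫⁻ ξ, g (R • (ξ - v)) ∂σ) * (∫⁻ η, W η * h (v - R⁻¹ • η)) ≤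
      ENNReal.ofReal (R ^ Module.finrank ℝ V)⁻¹ * (∫⁻ v, g v) * ((∫⁻ η, W η) * T) := by
  have hJm : Measurable fun v => ∫⁻ η, W η * h (v - R⁻¹ • η) :=
    Measurable.lintegral_prod_right' (f := fun p : V × V => W p.2 * h (p.1 - R⁻¹ • p.2))
      (by fun_prop)
  have hJ : ∀ t, ∫⁻ ξ, (∫⁻ η, W η * h (ξ - t - R⁻¹ • η)) ∂σ ≤ (∫⁻ η, W η) * T := by
    intro t
    rw [lintegral_lintegral_swap (by fun_prop), ← lintegral_mul_const _ hW]
    refine lintegral_mono fun η => ?_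
    rw [lintegral_const_mul _ (by fun_prop)]
    gcongr
    refine le_trans (le_of_eq ?_) (hT (t + R⁻¹ • η))
    simp_rw [sub_sub]
  calc _ = ∫⁻ v, ∫⁻ ξ, g (R • (ξ - v)) * (∫⁻ η, W η * h (v - R⁻¹ • η)) ∂σ := by
        refine lintegral_congr fun v => ?_
        rw [lintegral_mul_const _ (by fun_prop)]
    _ = ∫⁻ ξ, (∫⁻ v, g (R • (ξ - v)) * (∫⁻ η, W η * h (v - R⁻¹ • η))) ∂σ := by
        rw [lintegral_lintegral_swap]
        exact ((hg.comp (by fun_prop)).mul (hJm.comp measurable_fst)).aemeasurable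
    _ = ∫⁻ ξ, (∫⁻ t, g (R • t) * (∫⁻ η, W η * h (ξ - t - R⁻¹ • η))) ∂σ := by
        refine lintegral_congr fun ξ => ?_
        rw [← lintegral_sub_left_eq_self _ ξ]
        simp
    _ = ∫⁻ t, g (R • t) * (∫⁻ ξ, (∫⁻ η, W η * h (ξ - t - R⁻¹ • η)) ∂σ) := by
        have hm : Measurable fun p : V × V => ∫⁻ η, W η * h (p.1 - p.2 - R⁻¹ • η) :=
          hJm.comp (measurable_fst.sub measurable_snd)
        rw [lintegral_lintegral_swap]
        · refine lintegral_congr fun t => ?_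
          exact lintegral_const_mul _ (hJm.comp (measurable_id.sub_const t))
        · exact ((hg.comp (by fun_prop)).mul hm).aemeasurable
    _ ≤ ∫⁻ t, g (R • t) * ((∫⁻ η, W η) * T) := by
        gcongr with t
        exact hJ t
    _ = _ := by
        rw [lintegral_mul_const _ (by fun_prop)]
        congr 1
        have := lintegral_comp_smul_sub hg hR 0
        rw [← this, ← lintegral_neg_eq_self]
        simp

end Scaling

/-! ### Restriction estimates for sparse families of balls. -/

section Sparse

variable {V : Type*} [NormedAddCommGroup V] [InnerProductSpace ℝ V] [FiniteDimensional ℝ V]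
  [MeasurableSpace V] [BorelSpace V]

theorem volume_closedBall_rpow_le (c : V) {R θ : ℝ} (hR : 1 ≤ R) (h0 : 0 ≤ θ) (h1 : θ ≤ 1) :
    volume (Metric.closedBall c R) ^ θ ≤ ENNReal.ofReal
      (max 1 (volume (Metric.closedBall (0 : V) 1)).toReal * R ^ Module.finrank ℝ V) := by
  have hv : volume (Metric.closedBall (0 : V) 1) ≠ ⊤ := measure_closedBall_lt_top.ne
  set β := max 1 (volume (Metric.closedBall (0 : V) 1)).toReal with hβ
  have hβ1 : 1 ≤ β := le_max_left _ _
  have hRN : 1 ≤ R ^ Module.finrank ℝ V := one_le_pow₀ hR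
  have h2 : volume (Metric.closedBall c R) ≤ ENNReal.ofReal (β * R ^ Module.finrank ℝ V) := by
    rw [Measure.addHaar_closedBall' volume c (by linarith), mul_comm,
      ENNReal.ofReal_mul (by linarith), ← ENNReal.ofReal_toReal hv]
    gcongr
    exact le_max_right _ _
  have h3 : 1 ≤ ENNReal.ofReal (β * R ^ Module.finrank ℝ V) := by
    rw [ENNReal.one_le_ofReal]; nlinarith
  calc _ ≤ ENNReal.ofReal (β * R ^ Module.finrank ℝ V) ^ θ := ENNReal.rpow_le_rpow h2 h0
    _ ≤ ENNReal.ofReal (β * R ^ Module.finrank ℝ V) ^ (1 : ℝ) :=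
        ENNReal.rpow_le_rpow_of_exponent_le h3 h1
    _ = _ := ENNReal.rpow_one _

/-- Points of the two supports are at distance at least `D - 2R ≥ D / 2`, which is where `4 * R ≤ D`
enters. -/
theorem norm_integral_offdiag_le {σ : Measure V} [IsFiniteMeasure σ] {ρ C R D : ℝ} (hρ : 0 < ρ)
    (hC : 0 ≤ C) (hR : 1 ≤ R) (hD : 4 * R ≤ D) {φ : V → ℂ} (hφ : Continuous φ)
    (hφ1 : ∀ ξ, ‖φ ξ‖ ≤ 1) {v : V}
    (hdec : ∀ z : V, ‖∫ ξ, φ (R • (ξ - v)) * (𝐞 (-inner ℝ ξ z) : ℂ) ∂σ‖ ≤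
      C * R ^ ρ * (1 + ‖z‖) ^ (-ρ))
    {f g : V → ℂ} (hf : Integrable f) (hg : Integrable g) {x y : V}
    (hfs : Function.support f ⊆ Metric.closedBall x R)
    (hgs : Function.support g ⊆ Metric.closedBall y R) (hxy : D ≤ dist x y) {b : ℝ}
    (hfb : ∫ x, ‖f x‖ ≤ b) (hgb : ∫ x, ‖g x‖ ≤ b) :
    ‖∫ ξ, φ (R • (ξ - v)) * (𝓕 f ξ * (starRingEnd ℂ) (𝓕 g ξ)) ∂σ‖ ≤
      C * R ^ ρ * (D / 2) ^ (-ρ) * b ^ 2 := by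
  have hR0 : 0 < R := by linarith
  have hD0 : 0 < D := by linarith
  have h1 := norm_integral_fourier_mul_conj_fourier_le (σ := σ) (w := fun ξ => φ (R • (ξ - v)))
    (hφ.comp (by fun_prop)) (M := 1) (fun ξ => hφ1 _) hf hg
    (κ := C * R ^ ρ * (D / 2) ^ (-ρ)) (fun x' hx' y' hy' => by
      refine (hdec _).trans ?_
      gcongr C * R ^ ρ * ?_
      refine Real.rpow_le_rpow_of_nonpos (by positivity) ?_ (by linarith)
      have h2 : dist x' x ≤ R := hfs hx'
      have h3 : dist y' y ≤ R := hgs hy'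
      have h4 := dist_triangle4 x x' y' y
      rw [dist_comm x x'] at h4
      rw [← dist_eq_norm]
      linarith)
  have hb0 : 0 ≤ b := (integral_nonneg fun x => norm_nonneg _).trans hfb
  refine h1.trans ?_
  rw [mul_assoc _ (∫ x, ‖f x‖), sq]
  gcongr

/-- Restriction estimates at scale `R` add up in the `ℓ^p` sense over widely separated balls. -/
theorem exists_sparse_restriction {σ : Measure V} [IsFiniteMeasure σ] {M : ℝ}
    (hM : σ (Metric.closedBall 0 M)ᶜ = 0) {ρ A : ℝ} (hρ : 0 < ρ)
    (hdec : ∀ z : V, ‖∫ ξ, (𝐞 (-inner ℝ ξ z) : ℂ) ∂σ‖ ≤ A * (1 + ‖z‖) ^ (-ρ))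
    {p q : ℝ} (hp : 1 ≤ p) (hpq : p ≤ q) (hq2 : q ≤ 2) :
    ∃ C : ℝ≥0∞, C ≠ ⊤ ∧ ∀ (R D : ℝ) (T : ℝ≥0∞), 1 ≤ R → 4 * R ≤ D → 1 ≤ T →
      (∀ (c : V) (f : V → ℂ), MemLp f (ENNReal.ofReal p) →
        Function.support f ⊆ Metric.closedBall c R →
        ∫⁻ ξ, ‖𝓕 f ξ‖ₑ ^ q ∂σ ≤ T * eLpNorm f (ENNReal.ofReal p) volume ^ q) →
      ∀ (s : Finset V) (f : V → V → ℂ),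
        (s.card : ℝ) ^ 2 * R ^ ρ * R ^ (4 * Module.finrank ℝ V) ≤ D ^ ρ →
        (∀ x ∈ s, ∀ y ∈ s, x ≠ y → D ≤ dist x y) →
        (∀ x ∈ s, MemLp (f x) (ENNReal.ofReal p)) →
        (∀ x ∈ s, Function.support (f x) ⊆ Metric.closedBall x R) →
        ∫⁻ ξ, ‖∑ x ∈ s, 𝓕 (f x) ξ‖ₑ ^ q ∂σ ≤
          C * T * (∑ x ∈ s, eLpNorm (f x) (ENNReal.ofReal p) volume ^ p) ^ (q / p) := by
  classical
  obtain ⟨W, hWm, hW, hWF⟩ := exists_weight_enorm_fourier_le (V := V)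
  let b₀ : ContDiffBump (0 : V) := ⟨1 / 2, 1, by norm_num, by norm_num⟩
  obtain ⟨CD, hCD0, hCD⟩ := exists_norm_integral_schwartz_smul_le hρ.le hdec b₀.toSchwartz
  set N := Module.finrank ℝ V
  set I := ∫⁻ v, ENNReal.ofReal (b₀ v) with hI
  have hI0 : I ≠ 0 := by
    rw [hI, ← ofReal_integral_eq_lintegral_ofReal b₀.integrable
      (Filter.Eventually.of_forall fun v => b₀.nonneg)]
    simpa using b₀.integral_pos
  have hIt : I ≠ ⊤ := b₀.integrable.lintegral_lt_top.ne
  set β := max 1 (volume (Metric.closedBall (0 : V) 1)).toReal with hβ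
  have hβ1 : 1 ≤ β := le_max_left _ _
  set m₀ := max 1 (σ Set.univ)
  set W₁ := ∫⁻ η, W η
  set B := Metric.closedBall (0 : V) (M + 1)
  set K := CD * 2 ^ ρ * β ^ 2
  have hK0 : 0 ≤ K := by positivity
  have hp0 : 0 < p := by linarith
  have hq1 : 1 ≤ q := by linarith
  have hq0 : 0 < q := by linarith
  -- The first summand comes from the diagonal, the second from the off-diagonal error integrated
  -- over the frequency centres. The factor `I⁻¹` undoes the averaging, which reproduces the
  -- integral with the factor `R^{-N} I`.
  refine ⟨I⁻¹ * (I * (W₁ ^ (q - 1) * W₁) + volume B * m₀ * ENNReal.ofReal K ^ (q / 2)), ?_, ?_⟩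
  · have h1 : W₁ ^ (q - 1) ≠ ⊤ := ENNReal.rpow_ne_top_of_nonneg (by linarith) hW
    have h2 : volume B ≠ ⊤ := measure_closedBall_lt_top.ne
    have h3 : m₀ ≠ ⊤ := by simp [m₀]
    have h4 : ENNReal.ofReal K ^ (q / 2) ≠ ⊤ :=
      ENNReal.rpow_ne_top_of_nonneg (by positivity) ENNReal.ofReal_ne_top
    have h5 : I⁻¹ ≠ ⊤ := ENNReal.inv_ne_top.2 hI0
    finiteness
  intro R D T hR hD hT hloc s f hcard hsep hfL hfs
  have hR0 : 0 < R := by linarith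
  have hD0 : 0 < D := by linarith
  set P := (∑ x ∈ s, eLpNorm (f x) (ENNReal.ofReal p) volume ^ p) ^ (1 / p) with hP
  have hPq : (∑ x ∈ s, eLpNorm (f x) (ENNReal.ofReal p) volume ^ p) ^ (q / p) = P ^ q := by
    rw [hP, ← ENNReal.rpow_mul, one_div_mul_eq_div]
  have hfP : ∀ x ∈ s, eLpNorm (f x) (ENNReal.ofReal p) volume ≤ P := by
    intro x hx
    calc _ = (eLpNorm (f x) (ENNReal.ofReal p) volume ^ p) ^ (1 / p) := by
          rw [← ENNReal.rpow_mul, mul_one_div_cancel hp0.ne', ENNReal.rpow_one]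
      _ ≤ _ := ENNReal.rpow_le_rpow (Finset.single_le_sum
          (f := fun x => eLpNorm (f x) (ENNReal.ofReal p) volume ^ p) (fun _ _ => zero_le)
          hx) (by positivity)
  have hPt : P ≠ ⊤ := ENNReal.rpow_ne_top_of_nonneg (by positivity)
    (ENNReal.sum_ne_top.2 fun x hx => ENNReal.rpow_ne_top_of_nonneg hp0.le (hfL x hx).2.ne)
  have hfsum : ∑ x ∈ s, eLpNorm (f x) (ENNReal.ofReal p) volume ^ q ≤ P ^ q := by
    rw [← hPq]
    refine le_trans (le_of_eq ?_) (ENNReal.sum_rpow_le_rpow_sum s _ ((one_le_div hp0).2 hpq))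
    refine Finset.sum_congr rfl fun x _ => ?_
    rw [← ENNReal.rpow_mul, mul_div_cancel₀ _ hp0.ne']
  have hp' : 0 ≤ 1 - 1 / p := by rw [sub_nonneg, div_le_one hp0]; exact hp
  have hfi : ∀ x ∈ s, Integrable (f x) := fun x hx =>
    integrable_of_support_subset hp (hfL x hx) (hfs x hx) measure_closedBall_lt_top.ne
  set b := β * R ^ N * P.toReal with hb
  have hb0 : 0 ≤ b := by positivity
  have hfb : ∀ x ∈ s, ∫ y, ‖f x y‖ ≤ b := by
    intro x hx
    rw [integral_norm_eq_lintegral_enorm (hfi x hx).1]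
    refine ENNReal.toReal_le_of_le_ofReal hb0
      ((lintegral_enorm_le_of_support_subset hp (hfL x hx).1 (hfs x hx)).trans ?_)
    rw [hb, mul_comm, ENNReal.ofReal_mul (by positivity), ENNReal.ofReal_toReal hPt]
    gcongr
    · exact volume_closedBall_rpow_le x hR hp' (by simp; positivity)
    · exact hfP x hx
  have hab : ∀ x ∈ s, ∀ ξ, ‖𝓕 (f x) ξ‖ ≤ b := fun x hx ξ =>
    (VectorFourier.norm_fourierIntegral_le_integral_norm _ _ _ _ _).trans (hfb x hx)
  have hac : ∀ x ∈ s, Continuous (𝓕 (f x)) := fun x hx => continuous_fourier (hfi x hx)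
  set κ := CD * R ^ ρ * (D / 2) ^ (-ρ) * b ^ 2 with hκ
  have hκ0 : 0 ≤ κ := by positivity
  -- This accounts for `R ^ (4 * N)` in the separation hypothesis: `R ^ (2 * N)` pays for the
  -- passage from `L^p` to `L^1` in `b ^ 2`, and `R ^ (2 * N)` leaves the gain `(R ^ N)⁻¹` squared.
  -- The gain is needed because the error is integrated over a ball of fixed size, while the main
  -- terms carry `r = R^{-N}`.
  have hκle : s.card ^ 2 * κ ≤ K * ((R ^ N)⁻¹ * P.toReal) ^ 2 := by
    have h1 : (D / 2) ^ (-ρ) = 2 ^ ρ * (D ^ ρ)⁻¹ := by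
      rw [Real.div_rpow hD0.le (by norm_num), Real.rpow_neg hD0.le,
        Real.rpow_neg (by norm_num : (0 : ℝ) ≤ 2), div_inv_eq_mul, mul_comm]
    have hDρ : 0 < D ^ ρ := Real.rpow_pos_of_pos hD0 _
    have h2 : (s.card : ℝ) ^ 2 * R ^ ρ * (D ^ ρ)⁻¹ * (R ^ N) ^ 2 ≤ ((R ^ N)⁻¹) ^ 2 := by
      rw [inv_pow, ← one_div ((R ^ N) ^ 2), le_div_iff₀ (by positivity)]
      calc _ = (s.card : ℝ) ^ 2 * R ^ ρ * R ^ (4 * N) * (D ^ ρ)⁻¹ := by ring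
        _ ≤ D ^ ρ * (D ^ ρ)⁻¹ := by gcongr
        _ = 1 := mul_inv_cancel₀ hDρ.ne'
    calc _ = K * P.toReal ^ 2 * ((s.card : ℝ) ^ 2 * R ^ ρ * (D ^ ρ)⁻¹ * (R ^ N) ^ 2) := by
          rw [hκ, h1, hb]; ring
      _ ≤ K * P.toReal ^ 2 * ((R ^ N)⁻¹) ^ 2 := by gcongr
      _ = _ := by ring
  set r := ENNReal.ofReal (R ^ N)⁻¹ with hr
  have hRN : 0 < R ^ N := by positivity
  have hr1 : r ≤ 1 := by
    rw [hr, ENNReal.ofReal_le_one]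
    exact inv_le_one_of_one_le₀ (one_le_pow₀ hR)
  have hr0 : r ≠ 0 := by simpa [hr] using hRN
  have hrt : r ≠ ⊤ := ENNReal.ofReal_ne_top
  have hε : ENNReal.ofReal (s.card ^ 2 * κ) ^ (q / 2) ≤
      ENNReal.ofReal K ^ (q / 2) * (r * P ^ q) := by
    calc _ ≤ (ENNReal.ofReal K * (r * P) ^ 2) ^ (q / 2) := by
          refine ENNReal.rpow_le_rpow ((ENNReal.ofReal_le_ofReal hκle).trans (le_of_eq ?_))
            (by positivity)
          rw [ENNReal.ofReal_mul hK0, ENNReal.ofReal_pow (by positivity),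
            ENNReal.ofReal_mul (p := (R ^ N)⁻¹) (by positivity), ENNReal.ofReal_toReal hPt]
      _ = ENNReal.ofReal K ^ (q / 2) * (r ^ q * P ^ q) := by
          rw [ENNReal.mul_rpow_of_nonneg _ _ (by positivity), ← ENNReal.rpow_natCast_mul,
            ← ENNReal.mul_rpow_of_nonneg _ _ hq0.le]
          congr 2
          push_cast; ring
      _ ≤ _ := by
          gcongr
          calc r ^ q ≤ r ^ (1 : ℝ) := ENNReal.rpow_le_rpow_of_exponent_ge hr1 hq1
            _ = r := ENNReal.rpow_one r
  have hb₀m : Measurable fun v => ENNReal.ofReal (b₀ v) := b₀.continuous.measurable.ennreal_ofReal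
  have hbv : ∀ v, Measurable fun ξ => ENNReal.ofReal (b₀ (R • (ξ - v))) := fun v =>
    hb₀m.comp (by fun_prop)
  have hbξ : ∀ ξ, Measurable fun v => ENNReal.ofReal (b₀ (R • (ξ - v))) := fun ξ =>
    hb₀m.comp (by fun_prop)
  set J : V → V → ℝ≥0∞ := fun x v =>
    W₁ ^ (q - 1) * ∫⁻ η, W η * ‖𝓕 (f x) (v - R⁻¹ • η)‖ₑ ^ q with hJ
  set m : V → ℝ≥0∞ := fun v => ∫⁻ ξ, ENNReal.ofReal (b₀ (R • (ξ - v))) ∂σ with hm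
  set E := ENNReal.ofReal K ^ (q / 2) * (r * P ^ q)
  have hmm : Measurable m := Measurable.lintegral_prod_right'
    (f := fun p : V × V => ENNReal.ofReal (b₀ (R • (p.2 - p.1)))) (hb₀m.comp (by fun_prop))
  have hmσ : ∀ v, m v ≤ σ Set.univ := by
    intro v
    rw [← lintegral_one]
    refine lintegral_mono fun ξ => ?_
    rw [ENNReal.ofReal_le_one]; exact b₀.le_one
  -- As `R ≥ 1`, the bump centred at `v` misses the support of `σ` unless `|v| ≤ M + 1`, so the
  -- constant error is integrated over a bounded set only.
  have hm0 : ∀ v, v ∉ B → m v = 0 := by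
    intro v hv
    change ∫⁻ ξ, ENNReal.ofReal (b₀ (R • (ξ - v))) ∂σ = 0
    rw [lintegral_eq_zero_iff (hbv v)]
    have hae : ∀ᵐ ξ ∂σ, ξ ∈ Metric.closedBall (0 : V) M := by rwa [ae_iff]
    filter_upwards [hae] with ξ hξ
    have : b₀ (R • (ξ - v)) = 0 := by
      refine b₀.zero_of_le_dist ?_
      rw [mem_closedBall_zero_iff] at hξ
      have hv' : M + 1 < ‖v‖ := by simpa [B] using hv
      rw [dist_zero_right, norm_smul, Real.norm_of_nonneg hR0.le]
      have h1 : ‖v‖ ≤ ‖ξ‖ + ‖ξ - v‖ := by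
        have := norm_sub_le ξ (ξ - v); simpa using this
      change 1 ≤ _
      nlinarith [norm_nonneg (ξ - v)]
    simp [this]
  set F : V → ℝ≥0∞ := fun ξ => ‖∑ x ∈ s, 𝓕 (f x) ξ‖ₑ ^ q with hF
  have hFm : Measurable F :=
    ((continuous_finsetSum s hac).measurable.enorm).pow_const q
  have hpt : ∀ v, ∫⁻ ξ, ENNReal.ofReal (b₀ (R • (ξ - v))) * F ξ ∂σ ≤
      ∑ x ∈ s, m v * J x v + B.indicator (fun _ => m₀ * E) v := by
    intro v
    by_cases hv : v ∈ B
    · rw [Set.indicator_of_mem hv, ← Finset.mul_sum]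
      have h1 := lintegral_mul_enorm_sum_rpow_le (σ := σ) s (w := fun ξ => b₀ (R • (ξ - v)))
        (b₀.continuous.comp (by fun_prop)) (fun ξ => b₀.nonneg) (M := 1) (fun ξ => b₀.le_one)
        hac hab hκ0
        (fun x hx y hy hxy => norm_integral_offdiag_le hρ hCD0 hR hD b₀.toSchwartz.continuous
          (fun ξ => by
            rw [b₀.toSchwartz_apply, Complex.norm_real, Real.norm_of_nonneg b₀.nonneg]
            exact b₀.le_one)
          (hCD R hR v) (hfi x hx) (hfi y hy) (hfs x hx) (hfs y hy) (hsep x hx y hy hxy)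
          (hfb x hx) (hfb y hy)) hq0 hq2 (J := fun x => J x v)
        (fun x hx ξ hξ => by
          have hξ1 : ‖R • (ξ - v)‖ ≤ 1 := by
            by_contra h
            exact hξ (b₀.zero_of_le_dist (by rw [dist_zero_right]; exact (not_le.1 h).le))
          calc _ ≤ (∫⁻ η, W η * ‖𝓕 (f x) (v - R⁻¹ • η)‖ₑ) ^ q :=
                ENNReal.rpow_le_rpow (hWF R hR0 x (f x) (hfi x hx) (hfs x hx) v ξ hξ1) hq0.le
            _ ≤ _ := lintegral_mul_rpow_le_of_one_le hWm
                ((hac x hx).measurable.comp (by fun_prop)).enorm hq1)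
      refine h1.trans ?_
      gcongr
      calc _ ≤ m₀ ^ (1 - q / 2) := ENNReal.rpow_le_rpow ((hmσ v).trans (le_max_right _ _))
            (by linarith)
        _ ≤ m₀ ^ (1 : ℝ) := ENNReal.rpow_le_rpow_of_exponent_le (le_max_left _ _) (by linarith)
        _ = m₀ := ENNReal.rpow_one _
    · have h0 := hm0 v hv
      have h1 : ∫⁻ ξ, ENNReal.ofReal (b₀ (R • (ξ - v))) * F ξ ∂σ = 0 := by
        change ∫⁻ ξ, ENNReal.ofReal (b₀ (R • (ξ - v))) ∂σ = 0 at h0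
        rw [lintegral_eq_zero_iff (hbv v)] at h0
        refine (lintegral_eq_zero_iff ((hbv v).mul hFm)).2 ?_
        filter_upwards [h0] with ξ hξ
        have : ENNReal.ofReal (b₀ (R • (ξ - v))) = 0 := hξ
        simp [this]
      rw [h1]; exact zero_le
  have htot : ∫⁻ v, ∫⁻ ξ, ENNReal.ofReal (b₀ (R • (ξ - v))) * F ξ ∂σ = r * I * ∫⁻ ξ, F ξ ∂σ := by
    rw [lintegral_lintegral_swap ((hb₀m.comp (by fun_prop)).mul
      (hFm.comp measurable_snd)).aemeasurable, ← lintegral_const_mul _ hFm]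
    refine lintegral_congr fun ξ => ?_
    rw [lintegral_mul_const _ (hbξ ξ), lintegral_comp_smul_sub hb₀m hR0]
  have hJi : ∀ x ∈ s, ∫⁻ v, m v * J x v ≤
      r * I * (W₁ ^ (q - 1) * W₁) * (T * eLpNorm (f x) (ENNReal.ofReal p) volume ^ q) := by
    intro x hx
    have hhm : Measurable fun ξ => ‖𝓕 (f x) ξ‖ₑ ^ q := ((hac x hx).measurable.enorm).pow_const q
    have h1 := lintegral_lintegral_average_le (σ := σ) hb₀m hWm hhm
      (T := T * eLpNorm (f x) (ENNReal.ofReal p) volume ^ q) (fun t => by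
        simp_rw [fourier_sub_shift]
        have hn : eLpNorm (fun y => 𝐞 (inner ℝ y t) • f x y) (ENNReal.ofReal p) volume =
            eLpNorm (f x) (ENNReal.ofReal p) volume :=
          eLpNorm_congr_enorm_ae (Filter.Eventually.of_forall fun y => Circle.enorm_smul _ _)
        rw [← hn]
        refine hloc x _ ⟨?_, ?_⟩ ?_
        · have := Real.continuous_fourierChar
          exact AEStronglyMeasurable.smul (Continuous.aestronglyMeasurable (by fun_prop))
            (hfL x hx).1
        · rw [hn]; exact (hfL x hx).2
        · intro y hy
          refine hfs x hx fun h0 => hy ?_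
          simp [h0]) hR0
    have hint : Measurable fun v => m v * ∫⁻ η, W η * ‖𝓕 (f x) (v - R⁻¹ • η)‖ₑ ^ q :=
      hmm.mul (Measurable.lintegral_prod_right'
        (f := fun p : V × V => W p.2 * ‖𝓕 (f x) (p.1 - R⁻¹ • p.2)‖ₑ ^ q)
        ((hWm.comp measurable_snd).mul (hhm.comp (by fun_prop))))
    calc _ = W₁ ^ (q - 1) * ∫⁻ v, m v * ∫⁻ η, W η * ‖𝓕 (f x) (v - R⁻¹ • η)‖ₑ ^ q := by
          rw [← lintegral_const_mul _ hint]
          refine lintegral_congr fun v => ?_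
          rw [hJ]; ring
      _ ≤ W₁ ^ (q - 1) *
          (r * I * (W₁ * (T * eLpNorm (f x) (ENNReal.ofReal p) volume ^ q))) := by gcongr
      _ = _ := by ring
  have hJm : ∀ x ∈ s, Measurable fun v => m v * J x v := fun x hx =>
    hmm.mul ((Measurable.lintegral_prod_right'
        (f := fun p : V × V => W p.2 * ‖𝓕 (f x) (p.1 - R⁻¹ • p.2)‖ₑ ^ q)
        ((hWm.comp measurable_snd).mul
          (((hac x hx).measurable.enorm.pow_const q).comp (by fun_prop)))).const_mul _)
  have hfin : r * I * ∫⁻ ξ, F ξ ∂σ ≤ r * ((I * (W₁ ^ (q - 1) * W₁) +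
      volume B * m₀ * ENNReal.ofReal K ^ (q / 2)) * (T * P ^ q)) := by
    rw [← htot]
    calc _ ≤ ∫⁻ v, (∑ x ∈ s, m v * J x v + B.indicator (fun _ => m₀ * E) v) :=
          lintegral_mono hpt
      _ = ∑ x ∈ s, (∫⁻ v, m v * J x v) + m₀ * E * volume B := by
          rw [lintegral_add_left (Finset.measurable_fun_sum s hJm), lintegral_finsetSum s hJm,
            lintegral_indicator_const measurableSet_closedBall]
      _ ≤ ∑ x ∈ s, r * I * (W₁ ^ (q - 1) * W₁) *
            (T * eLpNorm (f x) (ENNReal.ofReal p) volume ^ q) + m₀ * E * volume B := by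
          gcongr with x hx
          exact hJi x hx
      _ = r * I * (W₁ ^ (q - 1) * W₁) *
            (T * ∑ x ∈ s, eLpNorm (f x) (ENNReal.ofReal p) volume ^ q) +
            r * (volume B * m₀ * ENNReal.ofReal K ^ (q / 2)) * (1 * P ^ q) := by
          rw [Finset.mul_sum, Finset.mul_sum]; ring
      -- The assumption `1 ≤ T` lets the error term, which has no factor `T`, be absorbed.
      _ ≤ r * I * (W₁ ^ (q - 1) * W₁) * (T * P ^ q) +
            r * (volume B * m₀ * ENNReal.ofReal K ^ (q / 2)) * (T * P ^ q) := by gcongr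
      _ = _ := by ring
  rw [mul_assoc, ENNReal.mul_le_mul_iff_right hr0 hrt] at hfin
  rw [hPq]
  calc ∫⁻ ξ, F ξ ∂σ = I⁻¹ * (I * ∫⁻ ξ, F ξ ∂σ) := by
        rw [← mul_assoc, ENNReal.inv_mul_cancel hI0 hIt, one_mul]
    _ ≤ _ := by rw [mul_assoc, mul_assoc]; gcongr

end Sparse

/-! ### Covering a set by few sparse families of balls. -/

section SparseCover

theorem exists_finset_separated_cover {X : Type*} [PseudoMetricSpace X] {A : Set X}
    (hA : TotallyBounded A) {D : ℝ} (hD : 0 < D) :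
    ∃ Z : Finset X, (↑Z ⊆ A) ∧ (∀ x ∈ Z, ∀ y ∈ Z, x ≠ y → D ≤ dist x y) ∧
      ∀ x ∈ A, ∃ z ∈ Z, dist x z ≤ D := by
  set ε : NNReal := (D / 2).toNNReal with hε
  have hε0 : ε ≠ 0 := (Real.toNNReal_pos.2 (by positivity)).ne'
  have h2ε : ((2 * ε : NNReal) : ℝ) = D := by
    rw [NNReal.coe_mul, hε, Real.coe_toNNReal _ (by positivity)]
    push_cast; ring
  obtain ⟨C, -, hCf, hC⟩ := Metric.exists_finite_isCover_of_totallyBounded hε0 hA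
  have hp : Metric.packingNumber (2 * ε) A ≠ ⊤ := by
    refine ne_top_of_le_ne_top ?_ ((Metric.packingNumber_two_mul_le_externalCoveringNumber ε A).trans
      hC.externalCoveringNumber_le_encard)
    exact Set.encard_ne_top_iff.2 hCf
  have hfin : (Metric.maximalSeparatedSet (2 * ε) A).Finite := by
    rw [← Set.encard_ne_top_iff, Metric.encard_maximalSeparatedSet hp]; exact hp
  refine ⟨hfin.toFinset, by simpa using Metric.maximalSeparatedSet_subset, ?_, ?_⟩
  · intro x hx y hy hxy
    have h := Metric.isSeparated_maximalSeparatedSet (hfin.mem_toFinset.1 hx)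
      (hfin.mem_toFinset.1 hy) hxy
    have h' : ((2 * ε : NNReal) : ℝ≥0∞) < edist x y := h
    rw [edist_nndist, ENNReal.coe_lt_coe] at h'
    have h3 : ((2 * ε : NNReal) : ℝ) < dist x y := by exact_mod_cast h'
    linarith
  · intro x hx
    obtain ⟨z, hz, hxz⟩ := Metric.isCover_maximalSeparatedSet hp hx
    refine ⟨z, hfin.mem_toFinset.2 hz, ?_⟩
    have h' : edist x z ≤ ((2 * ε : NNReal) : ℝ≥0∞) := hxz
    rw [edist_nndist, ENNReal.coe_le_coe] at h'
    have h3 : dist x z ≤ ((2 * ε : NNReal) : ℝ) := by exact_mod_cast h'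
    linarith

/-- A finite measure carried by the unit neighbourhood of a totally bounded set is dominated by its
masses on a few sparse families of balls: at each centre some scale has controlled growth. -/
theorem exists_sparse_cover {X : Type*} [PseudoMetricSpace X] [MeasurableSpace X]
    {μ : Measure X} [IsFiniteMeasure μ] {A : Set X} (hA : TotallyBounded A)
    (hμ : ∀ᵐ y ∂μ, ∃ x ∈ A, dist y x ≤ 1) {r : ℕ → ℝ} (hr : ∀ k, 1 < r (k + 1)) {N : ℕ}
    (hN : 0 < N) {θ : ℝ≥0∞}
    (hθ : ∀ x ∈ A, μ Set.univ ≤ θ ^ N * μ (Metric.closedBall x (r 0))) :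
    ∃ Z : ℕ → Finset X, (∀ k, ↑(Z k) ⊆ A) ∧
      (∀ k, ∀ x ∈ Z k, ∀ y ∈ Z k, x ≠ y → r (k + 1) - 1 ≤ dist x y) ∧
      μ Set.univ ≤ ∑ k ∈ Finset.range N, θ * ∑ z ∈ Z k, μ (Metric.closedBall z (r k)) := by
  set P : ℕ → X → Prop := fun k x => μ (Metric.closedBall x (r (k + 1))) ≤
    θ * μ (Metric.closedBall x (r k)) with hP
  have hex : ∀ x ∈ A, ∃ k < N, P k x := by
    intro x hx
    -- If the mass grew by more than `θ` at each of `N` consecutive scales, the last ball would have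
    -- mass above `θ ^ N` times the first, hence above the total mass.
    by_contra! hcon
    have hlt : ∀ k, k < N → θ ^ (k + 1) * μ (Metric.closedBall x (r 0)) <
        μ (Metric.closedBall x (r (k + 1))) := by
      intro k
      induction k with
      | zero => intro hk; simpa using not_le.1 (hcon 0 hk)
      | succ k ih =>
        intro hk
        refine lt_of_le_of_lt ?_ (not_le.1 (hcon (k + 1) hk))
        rw [pow_succ', mul_assoc]
        gcongr
        exact (ih (by omega)).le
    obtain ⟨M, rfl⟩ : ∃ M, N = M + 1 := ⟨N - 1, by omega⟩
    exact absurd ((hlt M (by omega)).trans_le (measure_mono (Set.subset_univ _)))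
      (not_lt.2 (hθ x hx))
  -- The `- 1` leaves room for the points charged by `μ`, which are only within distance 1 of `A`:
  -- the balls of radius `r (k + 1)` about `Z` still cover them.
  have hZ : ∀ k, ∃ Z : Finset X, (↑Z ⊆ {x ∈ A | P k x}) ∧
      (∀ x ∈ Z, ∀ y ∈ Z, x ≠ y → r (k + 1) - 1 ≤ dist x y) ∧
      ∀ x ∈ {x ∈ A | P k x}, ∃ z ∈ Z, dist x z ≤ r (k + 1) - 1 := fun k =>
    exists_finset_separated_cover (hA.subset (Set.sep_subset _ _)) (by linarith [hr k])
  choose Z hZA hZs hZc using hZ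
  refine ⟨Z, fun k => (hZA k).trans (Set.sep_subset _ _), hZs, ?_⟩
  calc μ Set.univ ≤ μ (⋃ k ∈ Finset.range N, ⋃ z ∈ Z k, Metric.closedBall z (r (k + 1))) := by
        refine measure_mono_ae ?_
        filter_upwards [hμ] with y hy _
        obtain ⟨x, hx, hyx⟩ := hy
        obtain ⟨k, hk, hkx⟩ := hex x hx
        obtain ⟨z, hz, hxz⟩ := hZc k x ⟨hx, hkx⟩
        refine Set.mem_biUnion (Finset.mem_range.2 hk) (Set.mem_biUnion hz ?_)
        rw [Metric.mem_closedBall]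
        linarith [dist_triangle y x z]
    _ ≤ ∑ k ∈ Finset.range N, ∑ z ∈ Z k, μ (Metric.closedBall z (r (k + 1))) :=
        (measure_biUnion_finset_le _ _).trans
          (Finset.sum_le_sum fun k _ => measure_biUnion_finset_le _ _)
    _ ≤ _ := by
        refine Finset.sum_le_sum fun k _ => ?_
        rw [Finset.mul_sum]
        exact Finset.sum_le_sum fun z hz => (hZA k hz).2

end SparseCover

/-! ### The extension operator and the dual sparse estimate. -/

section Extension

variable {V : Type*} [NormedAddCommGroup V] [InnerProductSpace ℝ V] [FiniteDimensional ℝ V]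
  [MeasurableSpace V] [BorelSpace V]

/-- The Fourier extension operator `g ↦ (g dσ)^`. -/
noncomputable def fourierExtension (σ : Measure V) (g : V → ℂ) (x : V) : ℂ :=
  VectorFourier.fourierIntegral 𝐞 σ (innerₗ V).flip g x

theorem integral_fourier_mul_eq_integral_mul_fourierExtension {σ : Measure V} [IsFiniteMeasure σ]
    {f g : V → ℂ} (hf : Integrable f) (hg : Integrable g σ) :
    ∫ ξ, 𝓕 f ξ * g ξ ∂σ = ∫ x, f x * fourierExtension σ g x :=
  VectorFourier.integral_fourierIntegral_smul_eq_flip (e := 𝐞) (L := innerₗ V)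
    Real.continuous_fourierChar (by exact continuous_inner) hf hg

theorem continuous_fourierExtension {σ : Measure V} [IsFiniteMeasure σ] {g : V → ℂ}
    (hg : Integrable g σ) : Continuous (fourierExtension σ g) :=
  VectorFourier.fourierIntegral_continuous Real.continuous_fourierChar
    (by
      simp only [LinearMap.flip_apply, innerₗ_apply_apply]
      fun_prop) hg

theorem norm_fourierExtension_le (σ : Measure V) (g : V → ℂ) (x : V) :
    ‖fourierExtension σ g x‖ ≤ ∫ ξ, ‖g ξ‖ ∂σ :=
  VectorFourier.norm_fourierIntegral_le_integral_norm _ _ _ _ _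

theorem norm_fourierExtension_sub_le {σ : Measure V} [IsFiniteMeasure σ] {M : ℝ}
    (hM : σ (Metric.closedBall 0 M)ᶜ = 0) {g : V → ℂ} (hg : Integrable g σ) (x y : V) :
    ‖fourierExtension σ g x - fourierExtension σ g y‖ ≤
      2 * Real.pi * M * (∫ ξ, ‖g ξ‖ ∂σ) * dist x y := by
  have hint : ∀ x : V, Integrable (fun ξ => 𝐞 (-inner ℝ x ξ) • g ξ) σ := fun x =>
    (VectorFourier.fourierIntegral_convergent_iff Real.continuous_fourierChar
      (L := (innerₗ V).flip) (by
        simp only [LinearMap.flip_apply, innerₗ_apply_apply]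
        fun_prop) x).2 hg
  have h1 : fourierExtension σ g x - fourierExtension σ g y =
      ∫ ξ, (𝐞 (-inner ℝ x ξ) • g ξ - 𝐞 (-inner ℝ y ξ) • g ξ) ∂σ :=
    (integral_sub (hint x) (hint y)).symm
  have hae : ∀ᵐ ξ ∂σ, ξ ∈ Metric.closedBall (0 : V) M := by rwa [ae_iff]
  rw [h1]
  calc _ ≤ ∫ ξ, 2 * Real.pi * M * dist x y * ‖g ξ‖ ∂σ := by
        refine norm_integral_le_of_norm_le (hg.norm.const_mul _) ?_
        filter_upwards [hae] with ξ hξ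
        rw [mem_closedBall_zero_iff] at hξ
        rw [Circle.smul_def, Circle.smul_def, ← sub_smul, norm_smul]
        gcongr
        rw [Real.fourierChar_apply, Real.fourierChar_apply]
        have h2 : Complex.exp (↑(2 * Real.pi * -inner ℝ x ξ) * Complex.I) -
            Complex.exp (↑(2 * Real.pi * -inner ℝ y ξ) * Complex.I) =
            Complex.exp (↑(2 * Real.pi * -inner ℝ y ξ) * Complex.I) *
              (Complex.exp (Complex.I * ↑(2 * Real.pi * -inner ℝ (x - y) ξ)) - 1) := by
          rw [mul_sub, mul_one, ← Complex.exp_add, inner_sub_left]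
          congr 2
          push_cast; ring
        rw [h2, norm_mul, Complex.norm_exp_ofReal_mul_I, one_mul]
        refine Real.norm_exp_I_mul_ofReal_sub_one_le.trans ?_
        rw [norm_mul, Real.norm_of_nonneg (by positivity), norm_neg, mul_assoc (2 * Real.pi)]
        gcongr
        refine (norm_inner_le_norm _ _).trans ?_
        rw [mul_comm, ← dist_eq_norm]
        gcongr
    _ = _ := by rw [integral_const_mul]; ring

theorem enorm_integral_mul_le_of_lintegral_rpow_le_one {α : Type*} [MeasurableSpace α]
    {σ : Measure α} {q q' : ℝ} (hq : q.HolderConjugate q') {F g : α → ℂ}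
    (hF : AEMeasurable F σ) (hg : AEMeasurable g σ) (hg1 : ∫⁻ ξ, ‖g ξ‖ₑ ^ q' ∂σ ≤ 1) :
    ‖∫ ξ, F ξ * g ξ ∂σ‖ₑ ≤ (∫⁻ ξ, ‖F ξ‖ₑ ^ q ∂σ) ^ (1 / q) := by
  calc _ ≤ ∫⁻ ξ, ‖F ξ‖ₑ * ‖g ξ‖ₑ ∂σ := by
        refine (enorm_integral_le_lintegral_enorm _).trans (le_of_eq ?_)
        simp_rw [enorm_mul]
    _ ≤ (∫⁻ ξ, ‖F ξ‖ₑ ^ q ∂σ) ^ (1 / q) * (∫⁻ ξ, ‖g ξ‖ₑ ^ q' ∂σ) ^ (1 / q') :=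
        ENNReal.lintegral_mul_le_Lp_mul_Lq σ hq hF.enorm hg.enorm
    _ ≤ (∫⁻ ξ, ‖F ξ‖ₑ ^ q ∂σ) ^ (1 / q) * 1 := by
        gcongr
        exact ENNReal.rpow_le_one hg1 (one_div_nonneg.2 hq.symm.pos.le)
    _ = _ := mul_one _

open ComplexConjugate in
/-- Dual form of a sparse restriction estimate, tested on a set where the extension is large. -/
theorem ofReal_mul_sum_volume_le {σ : Measure V} [IsFiniteMeasure σ] {p q q' : ℝ} (hp : 0 < p)
    (hq : q.HolderConjugate q') {g : V → ℂ} (hg : Integrable g σ)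
    (hg1 : ∫⁻ ξ, ‖g ξ‖ₑ ^ q' ∂σ ≤ 1) {Q : ℝ≥0∞} {R : ℝ} {s : Finset V}
    (hs : ∀ f : V → V → ℂ, (∀ x ∈ s, MemLp (f x) (ENNReal.ofReal p)) →
      (∀ x ∈ s, Function.support (f x) ⊆ Metric.closedBall x R) →
      ∫⁻ ξ, ‖∑ x ∈ s, 𝓕 (f x) ξ‖ₑ ^ q ∂σ ≤
        Q * (∑ x ∈ s, eLpNorm (f x) (ENNReal.ofReal p) volume ^ p) ^ (q / p))
    {E : Set V} (hE : MeasurableSet E) (hEv : volume E ≠ ⊤) {lam : ℝ}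
    (hlarge : ∀ x ∈ E, lam ≤ ‖fourierExtension σ g x‖) :
    ENNReal.ofReal lam * ∑ x ∈ s, volume (E ∩ Metric.closedBall x R) ≤
      Q ^ (1 / q) * (∑ x ∈ s, volume (E ∩ Metric.closedBall x R)) ^ (1 / p) := by
  set G := fourierExtension σ g with hG
  have hGc : Continuous G := continuous_fourierExtension hg
  -- With this unimodular factor (0 where `G` vanishes) the test functions satisfy `f_x G = |G|` on
  -- `E ∩ closedBall x R`, so pairing with `g` gives at least `lam` times the volumes.
  set u : V → ℂ := fun x => conj (G x) / (‖G x‖ : ℂ) with hu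
  have hum : Measurable u := ((Complex.continuous_conj.comp hGc).measurable).div
    (Complex.continuous_ofReal.comp hGc.norm).measurable
  have huG : ∀ x, u x * G x = (‖G x‖ : ℂ) := by
    intro x
    by_cases h0 : G x = 0
    · simp [hu, h0]
    · have : (‖G x‖ : ℂ) ≠ 0 := by simpa using h0
      rw [hu]
      field_simp
      rw [mul_comm, Complex.mul_conj']
  have hu1 : ∀ x, ‖u x‖ ≤ 1 := by
    intro x
    simp only [hu, norm_div, RCLike.norm_conj, Complex.norm_real, norm_norm]
    exact div_self_le_one _
  have hBm : ∀ x, MeasurableSet (E ∩ Metric.closedBall x R) := fun x =>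
    hE.inter measurableSet_closedBall
  have hBv : ∀ x, volume (E ∩ Metric.closedBall x R) ≠ ⊤ := fun x =>
    ne_top_of_le_ne_top hEv (measure_mono Set.inter_subset_left)
  set f : V → V → ℂ := fun x => (E ∩ Metric.closedBall x R).indicator u with hf
  have hfp : ∀ x, eLpNorm (f x) (ENNReal.ofReal p) volume ^ p ≤
      volume (E ∩ Metric.closedBall x R) := by
    intro x
    rw [eLpNorm_eq_lintegral_rpow_enorm_toReal (by simpa using hp) ENNReal.ofReal_ne_top,
      ENNReal.toReal_ofReal hp.le, ← ENNReal.rpow_mul, one_div_mul_cancel hp.ne', ENNReal.rpow_one,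
      ← lintegral_indicator_one (hBm x)]
    refine lintegral_mono fun y => ?_
    by_cases hy : y ∈ E ∩ Metric.closedBall x R
    · simp only [hf, Set.indicator_of_mem hy, Pi.one_apply]
      refine ENNReal.rpow_le_one ?_ hp.le
      rw [← ofReal_norm, ENNReal.ofReal_le_one]
      exact hu1 y
    · simp [hf, Set.indicator_of_notMem hy, hp]
  have hfm : ∀ x, AEStronglyMeasurable (f x) := fun x =>
    (hum.indicator (hBm x)).aestronglyMeasurable
  have hfL : ∀ x, MemLp (f x) (ENNReal.ofReal p) := by
    intro x
    refine ⟨hfm x, ?_⟩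
    by_contra h
    have h1 := hfp x
    rw [not_lt, top_le_iff] at h
    rw [h, ENNReal.top_rpow_of_pos hp, top_le_iff] at h1
    exact hBv x h1
  have hfs : ∀ x, Function.support (f x) ⊆ Metric.closedBall x R := fun x =>
    Set.support_indicator_subset.trans Set.inter_subset_right
  have hfi : ∀ x, Integrable (f x) := fun x =>
    (integrable_indicator_iff (hBm x)).2
      (Measure.integrableOn_of_bounded (M := 1) (hBv x) hum.aestronglyMeasurable
        (Filter.Eventually.of_forall hu1))
  have hpair : ∫ ξ, (∑ x ∈ s, 𝓕 (f x) ξ) * g ξ ∂σ =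
      ((∑ x ∈ s, ∫ y in E ∩ Metric.closedBall x R, ‖G y‖ : ℝ) : ℂ) := by
    have hFi : ∀ x, Integrable (fun ξ => 𝓕 (f x) ξ * g ξ) σ := fun x =>
      hg.bdd_mul (continuous_fourier (hfi x)).aestronglyMeasurable
        (Filter.Eventually.of_forall fun ξ =>
          VectorFourier.norm_fourierIntegral_le_integral_norm _ _ _ _ _)
    simp_rw [Finset.sum_mul]
    rw [integral_finsetSum s fun x _ => hFi x, Complex.ofReal_sum]
    refine Finset.sum_congr rfl fun x _ => ?_
    rw [integral_fourier_mul_eq_integral_mul_fourierExtension (hfi x) hg,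
      ← integral_complex_ofReal, ← integral_indicator (hBm x)]
    congr 1; ext y
    by_cases hy : y ∈ E ∩ Metric.closedBall x R
    · simp only [hf, Set.indicator_of_mem hy]; exact huG y
    · simp [hf, Set.indicator_of_notMem hy]
  have hlow : ENNReal.ofReal lam * ∑ x ∈ s, volume (E ∩ Metric.closedBall x R) ≤
      ‖∫ ξ, (∑ x ∈ s, 𝓕 (f x) ξ) * g ξ ∂σ‖ₑ := by
    have hnn : ∀ x ∈ s, 0 ≤ ∫ y in E ∩ Metric.closedBall x R, ‖G y‖ := fun x _ =>
      integral_nonneg fun y => norm_nonneg _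
    rw [hpair, ← ofReal_norm, Complex.norm_real, Real.norm_of_nonneg (Finset.sum_nonneg hnn),
      ENNReal.ofReal_sum_of_nonneg hnn, Finset.mul_sum]
    refine Finset.sum_le_sum fun x _ => ?_
    have hGi : IntegrableOn (fun y => ‖G y‖) (E ∩ Metric.closedBall x R) :=
      Measure.integrableOn_of_bounded (M := ∫ ξ, ‖g ξ‖ ∂σ) (hBv x)
        hGc.norm.aestronglyMeasurable (Filter.Eventually.of_forall fun y => by
          rw [norm_norm]; exact norm_fourierExtension_le σ g y)
    rw [ofReal_integral_eq_lintegral_ofReal hGi (Filter.Eventually.of_forall fun y => norm_nonneg _),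
      ← setLIntegral_const]
    exact setLIntegral_mono' (hBm x) fun y hy => ENNReal.ofReal_le_ofReal (hlarge y hy.1)
  refine hlow.trans ((enorm_integral_mul_le_of_lintegral_rpow_le_one hq
    (continuous_finsetSum s fun x _ => continuous_fourier (hfi x)).measurable.aemeasurable
    hg.1.aemeasurable hg1).trans ?_)
  have hq0 : 0 < q := hq.pos
  calc _ ≤ (Q * (∑ x ∈ s, eLpNorm (f x) (ENNReal.ofReal p) volume ^ p) ^ (q / p)) ^ (1 / q) :=
        ENNReal.rpow_le_rpow (hs f (fun x _ => hfL x) fun x _ => hfs x) (by positivity)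
    _ = Q ^ (1 / q) * (∑ x ∈ s, eLpNorm (f x) (ENNReal.ofReal p) volume ^ p) ^ (1 / p) := by
        rw [ENNReal.mul_rpow_of_nonneg _ _ (by positivity), ← ENNReal.rpow_mul]
        congr 2
        field_simp
    _ ≤ _ := by
        gcongr with x _
        exact hfp x

end Extension

/-! ### Choice of scales and the weak-type bound. -/

section LevelSets

/-- With `b = (2c+1)^k ≥ 1` one has `(b+1)c + 1 ≤ (2c+1)b`; the spare factor `n ≥ 2` absorbs the `-
1` required by the covering lemma. -/
theorem le_sub_one_of_iterated_pow {n : ℝ} (hn : 2 ≤ n) (c k : ℕ) :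
    (n * n ^ (2 * c + 1) ^ k) ^ c ≤ n ^ (2 * c + 1) ^ (k + 1) - 1 := by
  set b := (2 * c + 1) ^ k with hb
  have hb1 : 1 ≤ b := Nat.one_le_pow _ _ (by omega)
  have h1 : n * n ^ b = n ^ (b + 1) := by rw [pow_succ, mul_comm]
  have h2 : (b + 1) * c + 1 ≤ (2 * c + 1) ^ (k + 1) := by
    rw [pow_succ, ← hb]; nlinarith
  have h3 : n ^ ((b + 1) * c + 1) ≤ n ^ (2 * c + 1) ^ (k + 1) :=
    pow_le_pow_right₀ (by linarith) h2
  have h4 : 1 ≤ n ^ ((b + 1) * c) := one_le_pow₀ (by linarith)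
  rw [h1, ← pow_mul]
  rw [pow_succ] at h3
  nlinarith

/-- All factors on the left are powers of quantities at most `n * R`, with total exponent `ρ + 4d +
2`; this fixes how large `c` must be. -/
theorem sparse_separation {n R D ρ m : ℝ} {c d : ℕ} (hn : 2 ≤ n) (hR : 1 ≤ R) (hρ : 0 < ρ)
    (hm : 0 ≤ m) (hmn : m ≤ n) (hc : ρ + 4 * d + 2 ≤ c * ρ) (hD : (n * R) ^ c ≤ D) :
    m ^ 2 * R ^ ρ * R ^ (4 * d) ≤ D ^ ρ := by
  have hnR : 1 ≤ n * R := by nlinarith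
  have hnR0 : 0 < n * R := by linarith
  have hRn : R ≤ n * R := by nlinarith
  have hmnR : m ≤ n * R := by nlinarith
  calc m ^ 2 * R ^ ρ * R ^ (4 * d) ≤ (n * R) ^ 2 * (n * R) ^ ρ * (n * R) ^ (4 * d) := by
        gcongr
    _ = (n * R) ^ (2 + ρ + (4 * d : ℕ)) := by
        rw [Real.rpow_add hnR0, Real.rpow_add hnR0, Real.rpow_natCast]
        norm_cast
    _ ≤ (n * R) ^ (c * ρ) := by
        refine Real.rpow_le_rpow_of_exponent_le hnR ?_
        push_cast; linarith
    _ = ((n * R) ^ c) ^ ρ := by rw [Real.rpow_mul hnR0.le, Real.rpow_natCast]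
    _ ≤ _ := Real.rpow_le_rpow (by positivity) hD hρ.le

theorem ENNReal.le_ofReal_rpow_of_mul_le {x : ℝ≥0∞} (hx : x ≠ ⊤) {lam K p p' : ℝ}
    (hlam : 0 < lam) (hK : 0 ≤ K) (hp : p.HolderConjugate p')
    (h : ENNReal.ofReal lam * x ≤ ENNReal.ofReal K * x ^ (1 / p)) :
    x ≤ ENNReal.ofReal ((K / lam) ^ p') := by
  have hp0 := hp.pos
  have hp'0 := hp.symm.pos
  lift x to NNReal using hx
  rcases eq_or_ne x 0 with rfl | hx0
  · simp
  have hx1 : 0 < (x : ℝ) := by positivity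
  have h1 : lam * x ≤ K * (x : ℝ) ^ (1 / p) := by
    have := ENNReal.toReal_mono (by finiteness) h
    rwa [ENNReal.toReal_mul, ENNReal.toReal_mul, ENNReal.toReal_ofReal hlam.le,
      ENNReal.toReal_ofReal hK, ← ENNReal.toReal_rpow] at this
  have h2 : (x : ℝ) = x ^ (1 / p) * x ^ (1 / p') := by
    rw [← Real.rpow_add hx1, one_div, one_div, hp.inv_add_inv_eq_one, Real.rpow_one]
  have hxp : 0 < (x : ℝ) ^ (1 / p) := Real.rpow_pos_of_pos hx1 _
  have h3 : (x : ℝ) ^ (1 / p') ≤ K / lam := by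
    rw [le_div_iff₀ hlam]
    nth_rewrite 1 [h2] at h1
    have : (x : ℝ) ^ (1 / p) * ((x : ℝ) ^ (1 / p') * lam) ≤ (x : ℝ) ^ (1 / p) * K := by linarith
    exact le_of_mul_le_mul_left this hxp
  have h4 : (x : ℝ) ≤ (K / lam) ^ p' := by
    calc (x : ℝ) = ((x : ℝ) ^ (1 / p')) ^ p' := by
          rw [← Real.rpow_mul hx1.le, one_div_mul_cancel hp'0.ne', Real.rpow_one]
      _ ≤ _ := Real.rpow_le_rpow (by positivity) h3 hp'0.le
  rw [← ENNReal.ofReal_coe_nnreal]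
  exact ENNReal.ofReal_le_ofReal h4

/-- Solving the self-improving volume bound. -/
theorem le_rpow_of_le_mul_rpow {L lam v y A ε p' : ℝ} {d : ℕ} (hlam : 0 < lam) (hlamL : lam ≤ L)
    (hv : 0 < v) (hy : 0 ≤ y) (hA : 0 ≤ A) (hε0 : 0 ≤ ε) (hε1 : ε < 1) (hp' : 0 ≤ p')
    (h : y ≤ A * (2 + y / ((lam / (2 * L)) ^ d * v)) ^ ε * lam ^ (-p')) :
    y ≤ (2 * L ^ (p' + d) + A * (2 * L) ^ d / v) ^ (1 / (1 - ε)) * (v / (2 * L) ^ d) *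
      lam ^ (-((p' + d) / (1 - ε) - d)) := by
  have hL : 0 < L := by linarith
  have hε : 0 < 1 - ε := by linarith
  set κ := (lam / (2 * L)) ^ d * v with hκ
  have hκ0 : 0 < κ := by positivity
  set n := 2 + y / κ with hn
  have hn2 : 2 ≤ n := by have : 0 ≤ y / κ := by positivity
                         linarith
  have hn0 : 0 < n := by linarith
  set C := 2 * L ^ (p' + d) + A * (2 * L) ^ d / v with hC
  have hC0 : 0 < C := by positivity
  have hnε : 1 ≤ n ^ ε := Real.one_le_rpow (by linarith) hε0
  have h1 : 1 ≤ L ^ (p' + d) * lam ^ (-(p' + d)) := by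
    rw [Real.rpow_neg hlam.le, ← div_eq_mul_inv, one_le_div (by positivity)]
    exact Real.rpow_le_rpow hlam.le hlamL (by positivity)
  -- Rewriting the bound in terms of `n` puts the unknown on both sides; as `ε < 1`, the factor `n ^
  -- ε` can be divided out. The summand 2 in `n` is absorbed using `lam ≤ L`.
  have h2 : n ≤ C * lam ^ (-(p' + d)) * n ^ ε := by
    have hlamd : lam ^ (-p') / κ = (2 * L) ^ d / v * lam ^ (-(p' + d)) := by
      rw [hκ, neg_add, Real.rpow_add hlam, Real.rpow_neg hlam.le (d : ℝ), Real.rpow_natCast, div_pow]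
      field_simp
    have h3 : y / κ ≤ A * ((2 * L) ^ d / v * lam ^ (-(p' + d))) * n ^ ε := by
      rw [← hlamd]
      calc y / κ ≤ (A * n ^ ε * lam ^ (-p')) / κ := by gcongr
        _ = _ := by ring
    have h4 : 2 ≤ 2 * (L ^ (p' + d) * lam ^ (-(p' + d))) * n ^ ε := by nlinarith
    calc n = 2 + y / κ := hn
      _ ≤ _ := add_le_add h4 h3
      _ = _ := by rw [hC]; ring
  have h3 : n ^ (1 - ε) ≤ C * lam ^ (-(p' + d)) := by
    have hnε0 : 0 < n ^ ε := by linarith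
    rw [Real.rpow_sub hn0, Real.rpow_one, div_le_iff₀ hnε0]
    exact h2
  have h4 : n ≤ C ^ (1 / (1 - ε)) * lam ^ (-((p' + d) / (1 - ε))) := by
    calc n = (n ^ (1 - ε)) ^ (1 / (1 - ε)) := by
          rw [← Real.rpow_mul hn0.le, mul_one_div_cancel hε.ne', Real.rpow_one]
      _ ≤ (C * lam ^ (-(p' + d))) ^ (1 / (1 - ε)) :=
          Real.rpow_le_rpow (by positivity) h3 (by positivity)
      _ = _ := by
          rw [Real.mul_rpow hC0.le (by positivity), ← Real.rpow_mul hlam.le]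
          congr 2; ring
  calc y ≤ n * κ := by rw [hn, add_mul, div_mul_cancel₀ _ hκ0.ne']; linarith
    _ ≤ C ^ (1 / (1 - ε)) * lam ^ (-((p' + d) / (1 - ε))) * κ := by gcongr
    _ = _ := by
      rw [hκ, neg_sub, sub_eq_add_neg (d : ℝ), add_comm (d : ℝ), Real.rpow_add hlam,
        Real.rpow_natCast, div_pow]
      field_simp

variable {V : Type*} [NormedAddCommGroup V] [InnerProductSpace ℝ V] [FiniteDimensional ℝ V]
  [MeasurableSpace V] [BorelSpace V]

/-- A Lipschitz function whose sparse `L^p`-dual estimates lose only `R^α` satisfies a weak-type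
bound. -/
theorem exists_volume_superlevel_le {ρ α p p' L C₁ : ℝ} {c N : ℕ} (hρ : 0 < ρ) (hα : 0 ≤ α)
    (hp : p.HolderConjugate p') (hL : 0 < L) (hC₁ : 0 ≤ C₁) (hN : 0 < N) (hc3 : 3 ≤ c)
    (hc : ρ + 4 * Module.finrank ℝ V + 2 ≤ c * ρ)
    (hε : 1 / N + α * p' * (2 * c + 1 : ℝ) ^ N < 1) :
    ∃ C : ℝ, 0 ≤ C ∧ ∀ G : V → ℂ, Continuous G → (∀ x y, ‖G x - G y‖ ≤ L * dist x y) →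
      (∀ (E : Set V) (lam R D : ℝ) (s : Finset V), MeasurableSet E → volume E ≠ ⊤ →
        (∀ x ∈ E, lam ≤ ‖G x‖) → 1 ≤ R → 4 * R ≤ D →
        (s.card : ℝ) ^ 2 * R ^ ρ * R ^ (4 * Module.finrank ℝ V) ≤ D ^ ρ →
        (∀ x ∈ s, ∀ y ∈ s, x ≠ y → D ≤ dist x y) →
        ENNReal.ofReal lam * ∑ x ∈ s, volume (E ∩ Metric.closedBall x R) ≤
          ENNReal.ofReal (C₁ * R ^ α) *
            (∑ x ∈ s, volume (E ∩ Metric.closedBall x R)) ^ (1 / p)) →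
      ∀ lam : ℝ, 0 < lam → lam ≤ L →
        volume {x | lam < ‖G x‖} ≤ ENNReal.ofReal (C * lam ^ (-((p' + Module.finrank ℝ V) /
          (1 - (1 / N + α * p' * (2 * c + 1 : ℝ) ^ N)) - Module.finrank ℝ V))) := by
  set ε := 1 / N + α * p' * (2 * c + 1 : ℝ) ^ N with hεdef
  set d := Module.finrank ℝ V with hd
  have hp'0 : 0 < p' := hp.symm.pos
  have hε0 : 0 ≤ ε := by positivity
  set v := (volume (Metric.ball (0 : V) 1)).toReal with hv
  have hvt : volume (Metric.ball (0 : V) 1) ≠ ⊤ := measure_ball_lt_top.ne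
  have hv0 : 0 < v := ENNReal.toReal_pos (Metric.measure_ball_pos _ _ one_pos).ne' hvt
  set A := N * (2 * C₁) ^ p' with hA
  have hA0 : 0 ≤ A := by positivity
  refine ⟨(2 * L ^ (p' + d) + A * (2 * L) ^ d / v) ^ (1 / (1 - ε)) * (v / (2 * L) ^ d),
    by positivity, fun G hGc hGL hdual lam hlam hlamL => ?_⟩
  -- The superlevel set is not yet known to have finite volume; inner regularity reduces to compact
  -- subsets, with bounds independent of the subset.
  rw [(isOpen_lt continuous_const hGc.norm).measure_eq_iSup_isCompact]
  refine iSup_le fun K => iSup_le fun hKs => iSup_le fun hK => ?_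
  set δ := lam / (2 * L) with hδ
  have hδ0 : 0 < δ := by positivity
  have hδ1 : δ ≤ 1 / 2 := by rw [hδ, div_le_div_iff₀ (by positivity) two_pos]; linarith
  -- Halving the level makes room for a ball of radius `δ = lam / (2L)` about each point of `K`, by
  -- the Lipschitz bound; the unit neighbourhood keeps `E` bounded.
  set E := {x | lam / 2 < ‖G x‖} ∩ ⋃ x ∈ K, Metric.ball x 1 with hE
  have hEo : IsOpen E := (isOpen_lt continuous_const hGc.norm).inter
    (isOpen_biUnion fun x _ => Metric.isOpen_ball)
  have hEm : MeasurableSet E := hEo.measurableSet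
  have hEv : volume E ≠ ⊤ := by
    refine ne_top_of_le_ne_top ?_ (measure_mono Set.inter_subset_right)
    have : (⋃ x ∈ K, Metric.ball x 1) = Metric.thickening 1 K :=
      (Metric.thickening_eq_biUnion_ball).symm
    rw [this]
    exact (hK.isBounded.thickening).measure_lt_top.ne
  have hball : ∀ x ∈ K, Metric.ball x δ ⊆ E := by
    intro x hx y hy
    rw [Metric.mem_ball] at hy
    refine ⟨?_, Set.mem_biUnion hx (Metric.mem_ball.2 (by linarith))⟩
    have h1 : lam < ‖G x‖ := hKs hx
    have h2 := hGL x y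
    have h3 := norm_sub_norm_le (G x) (G y)
    have h4 : L * dist x y < lam / 2 := by
      rw [dist_comm] at hy
      calc L * dist x y < L * δ := by gcongr
        _ = lam / 2 := by rw [hδ]; field_simp
    change lam / 2 < ‖G y‖
    linarith
  have hKE : K ⊆ E := fun x hx => hball x hx (Metric.mem_ball_self hδ0)
  set κ := δ ^ d * v with hκ
  have hκ0 : 0 < κ := by positivity
  have hκv : ∀ x : V, volume (Metric.ball x δ) = ENNReal.ofReal κ := by
    intro x
    rw [Measure.addHaar_ball_of_pos _ _ hδ0, hκ, ENNReal.ofReal_mul (by positivity), hv,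
      ENNReal.ofReal_toReal hvt]
  set y := (volume E).toReal with hy
  have hy0 : 0 ≤ y := ENNReal.toReal_nonneg
  have hyE : volume E = ENNReal.ofReal y := (ENNReal.ofReal_toReal hEv).symm
  -- `y / κ` bounds the number of disjoint `δ`-balls in `E`. The 2 makes the radii `r k` below grow.
  set n := 2 + y / κ with hn
  have hn2 : 2 ≤ n := by have : 0 ≤ y / κ := by positivity
                         linarith
  have hn0 : 0 < n := by linarith
  have hyn : y ≤ n * κ := by rw [hn, add_mul, div_mul_cancel₀ _ hκ0.ne']; linarith
  set r : ℕ → ℝ := fun k => n ^ (2 * c + 1) ^ k with hr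
  have hr1 : ∀ k, 1 ≤ r k := fun k => one_le_pow₀ (by linarith)
  have hrD : ∀ k, (n * r k) ^ c ≤ r (k + 1) - 1 := fun k => le_sub_one_of_iterated_pow hn2 c k
  have hr4 : ∀ k, 4 * r k ≤ r (k + 1) - 1 := by
    intro k
    refine le_trans ?_ (hrD k)
    have h1 : 1 ≤ n * r k := by nlinarith [hr1 k]
    have h2 : 2 * r k ≤ n * r k := by nlinarith [hr1 k]
    calc 4 * r k ≤ (2 * r k) ^ 2 := by nlinarith [hr1 k]
      _ ≤ (n * r k) ^ 2 := pow_le_pow_left₀ (by linarith [hr1 k]) h2 2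
      _ ≤ _ := pow_le_pow_right₀ h1 (by omega)
  have hN0 : (N : ℝ) ≠ 0 := by exact_mod_cast hN.ne'
  have hμE : (volume.restrict E) Set.univ = volume E := by simp
  have : IsFiniteMeasure (volume.restrict E) := ⟨by rw [hμE]; exact hEv.lt_top⟩
  have hlow : ∀ x ∈ K, ∀ k, ENNReal.ofReal κ ≤ volume.restrict E (Metric.closedBall x (r k)) := by
    intro x hx k
    rw [Measure.restrict_apply measurableSet_closedBall, ← hκv x]
    refine measure_mono (Set.subset_inter (Metric.ball_subset_closedBall.trans
      (Metric.closedBall_subset_closedBall ?_)) (hball x hx))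
    linarith [hr1 k]
  obtain ⟨Z, hZK, hZs, hZ⟩ := exists_sparse_cover (μ := volume.restrict E) hK.totallyBounded
    (by
      filter_upwards [ae_restrict_mem hEm] with z hz
      obtain ⟨x, hx, hzx⟩ := Set.mem_iUnion₂.1 hz.2
      exact ⟨x, hx, (Metric.mem_ball.1 hzx).le⟩)
    (r := r) (fun k => by linarith [hr4 k, hr1 k]) hN (θ := ENNReal.ofReal (n ^ (1 / N : ℝ)))
    (fun x hx => by
      rw [hμE, ← ENNReal.ofReal_pow (by positivity), ← Real.rpow_natCast, ← Real.rpow_mul hn0.le,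
        one_div_mul_cancel hN0, Real.rpow_one, hyE]
      calc _ ≤ ENNReal.ofReal (n * κ) := ENNReal.ofReal_le_ofReal hyn
        _ = ENNReal.ofReal n * ENNReal.ofReal κ := ENNReal.ofReal_mul hn0.le
        _ ≤ _ := by gcongr; exact hlow x hx 0)
  -- The balls of radius `r k` about `Z k` are disjoint and each contains mass at least `κ` of `E`.
  have hcard : ∀ k, ((Z k).card : ℝ) ≤ n := by
    intro k
    have h1 : ((Z k).card : ℝ≥0∞) * ENNReal.ofReal κ ≤ volume E := by
      calc _ = ∑ z ∈ Z k, ENNReal.ofReal κ := by simp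
        _ ≤ ∑ z ∈ Z k, volume.restrict E (Metric.closedBall z (r k)) :=
            Finset.sum_le_sum fun z hz => hlow z (hZK k hz) k
        _ = volume.restrict E (⋃ z ∈ Z k, Metric.closedBall z (r k)) := by
            refine (measure_biUnion_finset ?_ fun z _ => measurableSet_closedBall).symm
            intro z hz w hw hzw
            refine Metric.closedBall_disjoint_closedBall ?_
            linarith [hZs k z hz w hw hzw, hr4 k, hr1 k]
        _ ≤ _ := (measure_mono (Set.subset_univ _)).trans hμE.le
    rw [hyE, ← ENNReal.ofReal_natCast, ← ENNReal.ofReal_mul (Nat.cast_nonneg _),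
      ENNReal.ofReal_le_ofReal_iff hy0] at h1
    exact le_of_mul_le_mul_right (h1.trans hyn) hκ0
  have hbound : y ≤ A * n ^ ε * lam ^ (-p') := by
    have hterm : ∀ k ∈ Finset.range N, ENNReal.ofReal (n ^ (1 / N : ℝ)) *
        ∑ z ∈ Z k, volume.restrict E (Metric.closedBall z (r k)) ≤
        ENNReal.ofReal ((2 * C₁) ^ p' * n ^ ε * lam ^ (-p')) := by
      intro k hk
      have h1 : ∑ z ∈ Z k, volume.restrict E (Metric.closedBall z (r k)) ≤
          ENNReal.ofReal ((C₁ * r k ^ α / (lam / 2)) ^ p') := by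
        simp_rw [Measure.restrict_apply measurableSet_closedBall, Set.inter_comm _ E]
        refine ENNReal.le_ofReal_rpow_of_mul_le ?_ (by positivity)
          (mul_nonneg hC₁ (Real.rpow_nonneg (by linarith [hr1 k]) _)) hp
          (hdual E (lam / 2) (r k) (r (k + 1) - 1) (Z k) hEm hEv (fun x hx => hx.1.le) (hr1 k)
            (hr4 k) (sparse_separation hn2 (hr1 k) hρ (Nat.cast_nonneg _) (hcard k) hc (hrD k))
            (hZs k))
        exact ENNReal.sum_ne_top.2 fun z _ =>
          ne_top_of_le_ne_top hEv (measure_mono Set.inter_subset_left)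
      have h2 : (C₁ * r k ^ α / (lam / 2)) ^ p' ≤
          (2 * C₁) ^ p' * n ^ (α * p' * (2 * c + 1 : ℝ) ^ N) * lam ^ (-p') := by
        have hrk : r k ^ α ≤ n ^ (α * (2 * c + 1 : ℝ) ^ N) := by
          rw [hr]
          simp only
          rw [← Real.rpow_natCast, ← Real.rpow_mul hn0.le]
          refine Real.rpow_le_rpow_of_exponent_le (by linarith) ?_
          rw [mul_comm]
          push_cast
          gcongr
          · linarith [Nat.cast_nonneg (α := ℝ) c]
          · exact (Finset.mem_range.1 hk).le
        calc _ ≤ (2 * C₁ * n ^ (α * (2 * c + 1 : ℝ) ^ N) * lam⁻¹) ^ p' := by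
              refine Real.rpow_le_rpow (div_nonneg (mul_nonneg hC₁
                (Real.rpow_nonneg (by linarith [hr1 k]) _)) (by positivity)) ?_ hp'0.le
              calc C₁ * r k ^ α / (lam / 2) = 2 * C₁ * r k ^ α * lam⁻¹ := by field_simp
                _ ≤ _ := by gcongr
          _ = _ := by
              rw [Real.mul_rpow (by positivity) (by positivity),
                Real.mul_rpow (by positivity) (by positivity), ← Real.rpow_mul hn0.le,
                Real.inv_rpow hlam.le, Real.rpow_neg hlam.le]
              congr 3; ring
      calc _ ≤ ENNReal.ofReal (n ^ (1 / N : ℝ)) * ENNReal.ofReal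
            ((2 * C₁) ^ p' * n ^ (α * p' * (2 * c + 1 : ℝ) ^ N) * lam ^ (-p')) := by
            gcongr
            exact h1.trans (ENNReal.ofReal_le_ofReal h2)
        _ = _ := by
            rw [← ENNReal.ofReal_mul (by positivity), hεdef, Real.rpow_add hn0]
            congr 1; ring
    have h3 := hZ.trans (Finset.sum_le_sum hterm)
    rw [hμE, hyE, ← ENNReal.ofReal_sum_of_nonneg (fun _ _ => by positivity),
      ENNReal.ofReal_le_ofReal_iff (Finset.sum_nonneg fun _ _ => by positivity)] at h3
    refine h3.trans (le_of_eq ?_)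
    rw [Finset.sum_const, Finset.card_range, nsmul_eq_mul, hA]
    ring
  calc volume K ≤ volume E := measure_mono hKE
    _ = ENNReal.ofReal y := hyE
    _ ≤ _ := ENNReal.ofReal_le_ofReal
        (le_rpow_of_le_mul_rpow hlam hlamL hv0 hy0 hA0 hε0 hε hp'0.le hbound)

end LevelSets

/-! ### From weak type to strong type by the layer-cake formula. -/

section WeakToStrong

/-- Boundedness of `G` removes levels above `L`, so only integrability at 0 is at stake, which holds
as soon as `t > r`. -/
theorem lintegral_enorm_rpow_le_of_superlevel {α : Type*} [MeasurableSpace α] {μ : Measure α}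
    {G : α → ℂ} (hG : Measurable G) {L C r t : ℝ} (ht : 0 < t) (hGL : ∀ x, ‖G x‖ ≤ L)
    (hC : 0 ≤ C)
    (h : ∀ lam, 0 < lam → lam ≤ L → μ {x | lam < ‖G x‖} ≤ ENNReal.ofReal (C * lam ^ (-r))) :
    ∫⁻ x, ‖G x‖ₑ ^ t ∂μ ≤ ENNReal.ofReal t *
      ∫⁻ lam in Set.Ioc 0 L, ENNReal.ofReal (C * lam ^ (t - 1 - r)) := by
  have h1 := lintegral_rpow_eq_lintegral_meas_lt_mul μ (f := fun x => ‖G x‖)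
    (Filter.Eventually.of_forall fun x => norm_nonneg _) hG.norm.aemeasurable ht
  have h2 : ∀ x, ‖G x‖ₑ ^ t = ENNReal.ofReal (‖G x‖ ^ t) := fun x => by
    rw [← ofReal_norm, ENNReal.ofReal_rpow_of_nonneg (norm_nonneg _) ht.le]
  simp_rw [h2]
  rw [h1]
  gcongr ENNReal.ofReal t * ?_
  rw [← lintegral_indicator measurableSet_Ioi, ← lintegral_indicator measurableSet_Ioc]
  refine lintegral_mono fun lam => ?_
  by_cases hlam : lam ∈ Set.Ioc 0 L
  · have hlam0 : 0 < lam := hlam.1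
    rw [Set.indicator_of_mem hlam, Set.indicator_of_mem (show lam ∈ Set.Ioi 0 from hlam0)]
    calc _ ≤ ENNReal.ofReal (C * lam ^ (-r)) * ENNReal.ofReal (lam ^ (t - 1)) := by
          gcongr; exact h lam hlam.1 hlam.2
      _ = _ := by
          rw [← ENNReal.ofReal_mul (by positivity), mul_assoc, ← Real.rpow_add hlam0]
          congr 3; ring
  · by_cases h0 : lam ∈ Set.Ioi (0 : ℝ)
    · have hL : L < lam := by
        by_contra hcon; exact hlam ⟨h0, not_lt.1 hcon⟩
      have hempty : {x | lam < ‖G x‖} = ∅ := by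
        ext x
        simp only [Set.mem_ofPred_eq, Set.mem_empty_iff_false, iff_false, not_lt]
        exact (hGL x).trans hL.le
      rw [Set.indicator_of_mem h0, hempty]
      simp
    · simp [Set.indicator_of_notMem h0]

theorem lintegral_Ioc_rpow_ne_top {L C e : ℝ} (hL : 0 ≤ L) (he : -1 < e) :
    ∫⁻ lam in Set.Ioc 0 L, ENNReal.ofReal (C * lam ^ e) ≠ ⊤ := by
  have h := (intervalIntegral.intervalIntegrable_rpow' (a := 0) (b := L) he).const_mul C
  rw [intervalIntegrable_iff_integrableOn_Ioc_of_le hL] at h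
  exact h.lintegral_lt_top.ne

end WeakToStrong

/-! ### From extension bounds back to restriction bounds. -/

section Duality

variable {V : Type*} [NormedAddCommGroup V] [InnerProductSpace ℝ V] [FiniteDimensional ℝ V]
  [MeasurableSpace V] [BorelSpace V]

open ComplexConjugate in
/-- An `L^{q'} → L^{s'}` bound for the extension operator gives an `L^s → L^q` restriction bound. -/
theorem eLpNorm_fourier_le_of_fourierExtension {σ : Measure V} [IsFiniteMeasure σ]
    {q q' s s' : ℝ} (hq : q.HolderConjugate q') (hs : s.HolderConjugate s') {Q : ℝ≥0∞}
    (hQ : ∀ g : V → ℂ, Integrable g σ → ∫⁻ ξ, ‖g ξ‖ₑ ^ q' ∂σ ≤ 1 →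
      ∫⁻ x, ‖fourierExtension σ g x‖ₑ ^ s' ≤ Q)
    {f : V → ℂ} (hf : Integrable f) :
    eLpNorm (𝓕 f) (ENNReal.ofReal q) σ ≤
      Q ^ (1 / s') * eLpNorm f (ENNReal.ofReal s) volume := by
  have hq0 := hq.pos
  have hq'0 := hq.symm.pos
  have hq1 : 0 < q - 1 := hq.sub_one_pos
  have hs0 := hs.pos
  have hs'0 := hs.symm.pos
  set h := 𝓕 f with hh
  have hhc : Continuous h := continuous_fourier hf
  set b := ∫ x, ‖f x‖ with hb
  have hhb : ∀ ξ, ‖h ξ‖ ≤ b := fun ξ =>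
    VectorFourier.norm_fourierIntegral_le_integral_norm _ _ _ _ _
  have hconv : ∀ ξ, ‖h ξ‖ₑ ^ q = ENNReal.ofReal (‖h ξ‖ ^ q) := fun ξ => by
    rw [← ofReal_norm, ENNReal.ofReal_rpow_of_nonneg (norm_nonneg _) hq0.le]
  have hint : Integrable (fun ξ => ‖h ξ‖ ^ q) σ := by
    refine Integrable.of_bound (C := b ^ q)
      (hhc.norm.rpow_const fun _ => Or.inr hq0.le).aestronglyMeasurable
      (Filter.Eventually.of_forall fun ξ => ?_)
    rw [Real.norm_of_nonneg (by positivity)]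
    exact Real.rpow_le_rpow (norm_nonneg _) (hhb ξ) hq0.le
  set I := ∫ ξ, ‖h ξ‖ ^ q ∂σ with hI
  have hI0 : 0 ≤ I := integral_nonneg fun ξ => by positivity
  have hIl : ∫⁻ ξ, ‖h ξ‖ₑ ^ q ∂σ = ENNReal.ofReal I := by
    simp_rw [hconv]
    exact (ofReal_integral_eq_lintegral_ofReal hint
      (Filter.Eventually.of_forall fun ξ => by positivity)).symm
  rw [eLpNorm_eq_lintegral_rpow_enorm_toReal (by simpa using hq0) ENNReal.ofReal_ne_top,
    ENNReal.toReal_ofReal hq0.le, hIl]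
  rcases hI0.eq_or_lt with hI0' | hIpos
  · simp [← hI0', hq0]
  -- The extremizer in Hölder's inequality, normalized in `L^{q'}`: its pairing with `h` is exactly
  -- the `L^q` norm of `h`.
  set g : V → ℂ := fun ξ => ((‖h ξ‖ ^ (q - 2) * I ^ (-(1 / q')) : ℝ) : ℂ) * conj (h ξ) with hg
  have hgn : ∀ ξ, ‖g ξ‖ = ‖h ξ‖ ^ (q - 1) * I ^ (-(1 / q')) := by
    intro ξ
    rw [hg]
    simp only
    rw [norm_mul, RCLike.norm_conj, Complex.norm_real, Real.norm_of_nonneg (by positivity)]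
    rcases (norm_nonneg (h ξ)).eq_or_lt with h0 | h0
    · rw [← h0, Real.zero_rpow hq1.ne']; simp
    · have : ‖h ξ‖ ^ (q - 1) = ‖h ξ‖ ^ (q - 2) * ‖h ξ‖ := by
        rw [← Real.rpow_add_one h0.ne']; congr 1; ring
      rw [this]; ring
  have hgm : Measurable g := by
    have hn : Measurable fun ξ => ‖h ξ‖ := hhc.norm.measurable
    exact (Complex.measurable_ofReal.comp ((hn.pow_const _).mul_const _)).mul
      (Complex.continuous_conj.comp hhc).measurable
  have hgi : Integrable g σ := by
    refine Integrable.of_bound (C := b ^ (q - 1) * I ^ (-(1 / q'))) hgm.aestronglyMeasurable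
      (Filter.Eventually.of_forall fun ξ => ?_)
    rw [hgn]
    gcongr
    exact hhb ξ
  have hg1 : ∫⁻ ξ, ‖g ξ‖ₑ ^ q' ∂σ ≤ 1 := by
    have h1 : ∀ ξ, ‖g ξ‖ₑ ^ q' = ENNReal.ofReal (‖h ξ‖ ^ q * I⁻¹) := by
      intro ξ
      rw [← ofReal_norm, ENNReal.ofReal_rpow_of_nonneg (norm_nonneg _) hq'0.le, hgn,
        Real.mul_rpow (by positivity) (by positivity), ← Real.rpow_mul (norm_nonneg _),
        ← Real.rpow_mul hI0, hq.sub_one_mul_conj, neg_mul, one_div_mul_cancel hq'0.ne',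
        Real.rpow_neg_one]
    simp_rw [h1]
    rw [← ofReal_integral_eq_lintegral_ofReal (hint.mul_const _)
      (Filter.Eventually.of_forall fun ξ => by positivity), integral_mul_const,
      mul_inv_cancel₀ hIpos.ne', ENNReal.ofReal_one]
  have hpair : ∫ ξ, h ξ * g ξ ∂σ = ((I ^ (1 / q) : ℝ) : ℂ) := by
    have h1 : ∀ ξ, h ξ * g ξ = ((‖h ξ‖ ^ q * I ^ (-(1 / q')) : ℝ) : ℂ) := by
      intro ξ
      rw [hg]
      simp only
      rw [mul_left_comm, Complex.mul_conj', ← Complex.ofReal_pow, ← Complex.ofReal_mul]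
      congr 1
      rcases (norm_nonneg (h ξ)).eq_or_lt with h0 | h0
      · rw [← h0, Real.zero_rpow hq0.ne']; simp
      · have : ‖h ξ‖ ^ q = ‖h ξ‖ ^ (q - 2) * ‖h ξ‖ ^ 2 := by
          rw [← Real.rpow_natCast, ← Real.rpow_add h0]; congr 1; push_cast; ring
        rw [this]; ring
    simp_rw [h1]
    rw [integral_complex_ofReal, integral_mul_const]
    congr 1
    change I * I ^ (-(1 / q')) = _
    nth_rewrite 1 [← Real.rpow_one I]
    rw [← Real.rpow_add hIpos]
    congr 1
    have := hq.inv_add_inv_eq_one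
    rw [one_div, one_div]; linarith
  have hfinal : ENNReal.ofReal I ^ (1 / q) = ‖∫ ξ, h ξ * g ξ ∂σ‖ₑ := by
    rw [hpair, ← ofReal_norm, Complex.norm_real, Real.norm_of_nonneg (by positivity),
      ENNReal.ofReal_rpow_of_nonneg hI0 (by positivity)]
  rw [hfinal, integral_fourier_mul_eq_integral_mul_fourierExtension hf hgi,
    eLpNorm_eq_lintegral_rpow_enorm_toReal (by simpa using hs0) ENNReal.ofReal_ne_top,
    ENNReal.toReal_ofReal hs0.le]
  calc _ ≤ ∫⁻ x, ‖f x‖ₑ * ‖fourierExtension σ g x‖ₑ := by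
        refine (enorm_integral_le_lintegral_enorm _).trans (le_of_eq ?_)
        simp_rw [enorm_mul]
    _ ≤ (∫⁻ x, ‖f x‖ₑ ^ s) ^ (1 / s) * (∫⁻ x, ‖fourierExtension σ g x‖ₑ ^ s') ^ (1 / s') :=
        ENNReal.lintegral_mul_le_Lp_mul_Lq _ hs hf.1.enorm
          (continuous_fourierExtension hgi).measurable.enorm.aemeasurable
    _ ≤ (∫⁻ x, ‖f x‖ₑ ^ s) ^ (1 / s) * Q ^ (1 / s') := by
        gcongr
        exact hQ g hgi hg1
    _ = _ := mul_comm _ _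

end Duality

/-! ### Optimizing the number of scales. -/

section Exponents

/-- Taking `N` as the integer part of `a / (2 log B)` gives `B ^ N ≤ α^{-1/2}`, so `α p' B ^ N ≤ p'
e^{-a/2}`, at most `8 / a` because `p' ≤ a`. Also `1 / N ≤ 4 log B / a`. The sum `ε` is thus at most
`(4 log B + 8) / a`, and the factor `1 + d` in `K` converts `ε` into the loss in the exponent. -/
theorem exists_scale_count {B a α p' d K : ℝ} (hB : 3 ≤ B) (hd : 0 ≤ d)
    (hK : K = (4 * Real.log B + 8) * (1 + d)) (hα : 0 < α) (ha : a = -Real.log α) (hp' : 2 ≤ p')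
    (ha0 : 0 < a) (hpa : K / a < 1 / p') :
    ∃ N : ℕ, 0 < N ∧ 1 / N + α * p' * B ^ N < 1 ∧
      1 / p' - K / a ≤ 1 / ((p' + d) / (1 - (1 / N + α * p' * B ^ N)) - d) := by
  have hlB : 1 ≤ Real.log B := by
    rw [Real.le_log_iff_exp_le (by linarith)]
    linarith [Real.exp_one_lt_d9]
  set c := 4 * Real.log B + 8 with hc
  have hcK : c ≤ K := by rw [hK]; nlinarith
  have hK1 : 1 ≤ K := by linarith
  have hp'a : K * p' < a := by
    rw [div_lt_div_iff₀ ha0 (by linarith)] at hpa; linarith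
  have h2K : 2 * K < a := by nlinarith
  set x := a / (2 * Real.log B) with hx
  have hx2 : 2 ≤ x := by
    rw [hx, le_div_iff₀ (by positivity)]; linarith
  set N := ⌊x⌋₊ with hN
  have hNx : (N : ℝ) ≤ x := Nat.floor_le (by linarith)
  have hxN : x < N + 1 := Nat.lt_floor_add_one x
  have hN2 : x / 2 ≤ N := by linarith
  have hN0 : 0 < N := by
    have : (0 : ℝ) < N := by linarith
    exact_mod_cast this
  have hN0' : (0 : ℝ) < N := by exact_mod_cast hN0
  have h1N : 1 / (N : ℝ) ≤ 4 * Real.log B / a := by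
    rw [div_le_div_iff₀ hN0' ha0]
    have : x * (2 * Real.log B) = a := by rw [hx]; field_simp
    nlinarith
  have hBN : B ^ N ≤ Real.exp (a / 2) := by
    have : B ^ N = Real.exp (N * Real.log B) := by
      rw [mul_comm, Real.exp_mul, Real.exp_log (by linarith), Real.rpow_natCast]
    rw [this]
    refine Real.exp_le_exp.2 ?_
    calc N * Real.log B ≤ x * Real.log B := by gcongr
      _ = a / 2 := by rw [hx]; field_simp
  have hαe : α = Real.exp (-a) := by rw [ha, neg_neg, Real.exp_log hα]
  have hsmall : α * p' * B ^ N ≤ 8 / a := by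
    have h1 : α * p' * B ^ N ≤ p' * Real.exp (-(a / 2)) := by
      calc α * p' * B ^ N ≤ Real.exp (-a) * p' * Real.exp (a / 2) := by rw [← hαe]; gcongr
        _ = p' * (Real.exp (-a) * Real.exp (a / 2)) := by ring
        _ = _ := by rw [← Real.exp_add]; congr 2; ring
    have h2 : a ^ 2 / 8 ≤ Real.exp (a / 2) := by
      have := Real.quadratic_le_exp_of_nonneg (x := a / 2) (by linarith)
      nlinarith
    have h3 : Real.exp (-(a / 2)) ≤ 8 / a ^ 2 := by
      rw [Real.exp_neg, inv_le_comm₀ (Real.exp_pos _) (by positivity), inv_div]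
      exact h2
    have h4 : p' ≤ a := by nlinarith
    calc _ ≤ p' * Real.exp (-(a / 2)) := h1
      _ ≤ a * (8 / a ^ 2) := by gcongr
      _ = _ := by field_simp
  set ε := 1 / (N : ℝ) + α * p' * B ^ N with hε
  have hε0 : 0 < ε := by positivity
  have hεc : ε ≤ c / a := by rw [hc, add_div]; linarith
  have hε1 : ε < 1 := by
    refine lt_of_le_of_lt hεc ?_
    rw [div_lt_one ha0]; linarith
  refine ⟨N, hN0, hε1, ?_⟩
  have h1ε : 0 < 1 - ε := by linarith
  have hr : (p' + d) / (1 - ε) - d = (p' + d * ε) / (1 - ε) := by field_simp; ring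
  have hpd : 0 < p' + d * ε := by positivity
  rw [hr, one_div_div]
  -- The difference equals `ε (d + p') / (p' (p' + d ε))`.
  have hdiff : 1 / p' - (1 - ε) / (p' + d * ε) ≤ ε * (1 + d) := by
    rw [div_sub_div _ _ (by linarith) hpd.ne', div_le_iff₀ (by positivity)]
    have h0 : p' ≤ p' * p' := by nlinarith
    have h1 : d + p' ≤ (1 + d) * (p' * p') := by nlinarith [mul_le_mul_of_nonneg_left h0 hd]
    have h2 : 0 ≤ ε * (1 + d) * (p' * (d * ε)) := by positivity
    nlinarith
  have hKa : ε * (1 + d) ≤ K / a := by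
    rw [hK, mul_div_right_comm]
    gcongr
  linarith

end Exponents

/-! ### Assembly for finite measures with Fourier decay. -/

section EpsilonRemoval

variable {V : Type*} [NormedAddCommGroup V] [InnerProductSpace ℝ V] [FiniteDimensional ℝ V]
  [MeasurableSpace V] [BorelSpace V]

theorem integral_norm_le_of_lintegral_rpow_le_one {α : Type*} [MeasurableSpace α] {σ : Measure α}
    [IsFiniteMeasure σ] {q q' : ℝ} (hq : q.HolderConjugate q') {g : α → ℂ} (hg : Integrable g σ)
    (hg1 : ∫⁻ ξ, ‖g ξ‖ₑ ^ q' ∂σ ≤ 1) :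
    ∫ ξ, ‖g ξ‖ ∂σ ≤ (σ Set.univ ^ (1 / q)).toReal := by
  rw [integral_norm_eq_lintegral_enorm hg.1]
  refine ENNReal.toReal_mono (ENNReal.rpow_ne_top_of_nonneg (one_div_nonneg.2 hq.pos.le)
    (measure_ne_top _ _)) ?_
  calc ∫⁻ ξ, ‖g ξ‖ₑ ∂σ = ∫⁻ ξ, 1 * ‖g ξ‖ₑ ∂σ := by simp
    _ ≤ (∫⁻ _, 1 ^ q ∂σ) ^ (1 / q) * (∫⁻ ξ, ‖g ξ‖ₑ ^ q' ∂σ) ^ (1 / q') :=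
        ENNReal.lintegral_mul_le_Lp_mul_Lq σ hq aemeasurable_const hg.1.enorm
    _ ≤ (∫⁻ _, 1 ^ q ∂σ) ^ (1 / q) * 1 := by
        gcongr
        exact ENNReal.rpow_le_one hg1 (one_div_nonneg.2 hq.symm.pos.le)
    _ = _ := by simp

/-- The sparse estimate for a measure satisfying a local restriction estimate, in dual form. -/
theorem exists_dual_sparse_estimate {σ : Measure V} [IsFiniteMeasure σ] {M : ℝ}
    (hM : σ (Metric.closedBall 0 M)ᶜ = 0) {ρ A : ℝ} (hρ : 0 < ρ)
    (hdec : ∀ z : V, ‖∫ ξ, (𝐞 (-inner ℝ ξ z) : ℂ) ∂σ‖ ≤ A * (1 + ‖z‖) ^ (-ρ))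
    {p q q' α A₁ : ℝ} (hp : 1 ≤ p) (hpq : p ≤ q) (hq2 : q ≤ 2) (hqq : q.HolderConjugate q')
    (hα : 0 ≤ α)
    (hloc : ∀ R : ℝ, 1 ≤ R → ∀ (c : V) (f : V → ℂ), MemLp f (ENNReal.ofReal p) →
      Function.support f ⊆ Metric.closedBall c R →
      eLpNorm (𝓕 f) (ENNReal.ofReal q) σ ≤
        ENNReal.ofReal (A₁ * (2 * R) ^ α) * eLpNorm f (ENNReal.ofReal p) volume) :
    ∃ C₁ : ℝ, 0 ≤ C₁ ∧ ∀ g : V → ℂ, Integrable g σ → ∫⁻ ξ, ‖g ξ‖ₑ ^ q' ∂σ ≤ 1 →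
      ∀ (E : Set V) (lam R D : ℝ) (s : Finset V), MeasurableSet E → volume E ≠ ⊤ →
        (∀ x ∈ E, lam ≤ ‖fourierExtension σ g x‖) → 1 ≤ R → 4 * R ≤ D →
        (s.card : ℝ) ^ 2 * R ^ ρ * R ^ (4 * Module.finrank ℝ V) ≤ D ^ ρ →
        (∀ x ∈ s, ∀ y ∈ s, x ≠ y → D ≤ dist x y) →
        ENNReal.ofReal lam * ∑ x ∈ s, volume (E ∩ Metric.closedBall x R) ≤
          ENNReal.ofReal (C₁ * R ^ α) *
            (∑ x ∈ s, volume (E ∩ Metric.closedBall x R)) ^ (1 / p) := by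
  obtain ⟨C, hC, hsp⟩ := exists_sparse_restriction hM hρ hdec hp hpq hq2
  have hq0 := hqq.pos
  -- Enlarging the constant to at least 1 secures the condition `1 ≤ T` of the sparse estimate.
  set A₂ := max A₁ 1 with hA₂
  have hA₂1 : 1 ≤ A₂ := le_max_right _ _
  refine ⟨(C ^ (1 / q)).toReal * (A₂ * 2 ^ α), by positivity, ?_⟩
  intro g hg hg1 E lam R D s hE hEv hlarge hR hD hcard hsep
  have hR0 : 0 < R := by linarith
  set t := A₂ * (2 * R) ^ α with ht
  have ht1 : 1 ≤ t := by
    have := Real.one_le_rpow (show 1 ≤ 2 * R by linarith) hα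
    nlinarith
  have hT1 : 1 ≤ ENNReal.ofReal t ^ q :=
    ENNReal.one_le_rpow (ENNReal.one_le_ofReal.2 ht1) hq0
  have h1 := ofReal_mul_sum_volume_le (Q := C * ENNReal.ofReal t ^ q) (p := p) (by linarith) hqq
    hg hg1 (s := s) (R := R)
    (fun f hfL hfs => hsp R D (ENNReal.ofReal t ^ q) hR hD hT1 (fun c u hu hus => by
      have h2 := hloc R hR c u hu hus
      rw [eLpNorm_eq_lintegral_rpow_enorm_toReal (by simpa using hq0) ENNReal.ofReal_ne_top,
        ENNReal.toReal_ofReal hq0.le] at h2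
      calc _ = ((∫⁻ ξ, ‖𝓕 u ξ‖ₑ ^ q ∂σ) ^ (1 / q)) ^ q := by
            rw [← ENNReal.rpow_mul, one_div_mul_cancel hq0.ne', ENNReal.rpow_one]
        _ ≤ (ENNReal.ofReal t * eLpNorm u (ENNReal.ofReal p) volume) ^ q := by
            refine ENNReal.rpow_le_rpow (h2.trans ?_) hq0.le
            gcongr
            exact mul_le_mul_of_nonneg_right (le_max_left A₁ 1) (by positivity)
        _ = _ := ENNReal.mul_rpow_of_nonneg _ _ hq0.le) s f hcard hsep hfL hfs)
    hE hEv hlarge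
  refine h1.trans (le_of_eq ?_)
  congr 1
  rw [ENNReal.mul_rpow_of_nonneg _ _ (by positivity), ← ENNReal.rpow_mul,
    mul_one_div_cancel hq0.ne', ENNReal.rpow_one, mul_assoc _ (A₂ * 2 ^ α),
    ENNReal.ofReal_mul ENNReal.toReal_nonneg,
    ENNReal.ofReal_toReal (ENNReal.rpow_ne_top_of_nonneg (by positivity) hC), ht,
    Real.mul_rpow (by norm_num) hR0.le, mul_assoc]

theorem exists_nat_sparse_exponent (d : ℕ) {ρ : ℝ} (hρ : 0 < ρ) :
    ∃ c : ℕ, 3 ≤ c ∧ ρ + 4 * d + 2 ≤ c * ρ := by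
  obtain ⟨c, hc⟩ := exists_nat_ge ((ρ + 4 * d + 2) / ρ)
  refine ⟨c + 3, by omega, ?_⟩
  rw [div_le_iff₀ hρ] at hc
  push_cast
  nlinarith

variable (V) in
/-- Removal of the loss `R^α` in local restriction estimates, for finite measures with compact
support and Fourier decay. -/
theorem exists_global_restriction {ρ : ℝ} (hρ : 0 < ρ) :
    ∃ K : ℝ, 0 < K ∧ ∀ (σ : Measure V) [IsFiniteMeasure σ] (M A : ℝ),
      σ (Metric.closedBall 0 M)ᶜ = 0 →
      (∀ z : V, ‖∫ ξ, (𝐞 (-inner ℝ ξ z) : ℂ) ∂σ‖ ≤ A * (1 + ‖z‖) ^ (-ρ)) →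
      ∀ p q α A₁ : ℝ, 1 ≤ p → p ≤ q → q ≤ 2 → 0 < α → α < 1 →
        (∀ R : ℝ, 1 ≤ R → ∀ (c : V) (f : V → ℂ), MemLp f (ENNReal.ofReal p) →
          Function.support f ⊆ Metric.closedBall c R →
          eLpNorm (𝓕 f) (ENNReal.ofReal q) σ ≤
            ENNReal.ofReal (A₁ * (2 * R) ^ α) * eLpNorm f (ENNReal.ofReal p) volume) →
        ∀ s : ℝ, 1 ≤ s → 1 / p + K / (-Real.log α) < 1 / s →
          ∃ A₃ : ℝ, ∀ f : V → ℂ, Integrable f →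
            eLpNorm (𝓕 f) (ENNReal.ofReal q) σ ≤
              ENNReal.ofReal A₃ * eLpNorm f (ENNReal.ofReal s) volume := by
  obtain ⟨c, hc3, hc⟩ := exists_nat_sparse_exponent (Module.finrank ℝ V) hρ
  have hc3' : (3 : ℝ) ≤ c := by exact_mod_cast hc3
  have hB : (3 : ℝ) ≤ 2 * c + 1 := by linarith
  have hlB : 0 < Real.log (2 * c + 1 : ℝ) := Real.log_pos (by linarith)
  set K := (4 * Real.log (2 * c + 1 : ℝ) + 8) * (1 + Module.finrank ℝ V) with hK
  have hK0 : 0 < K := by positivity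
  refine ⟨K, hK0, ?_⟩
  intro σ _ M A hM hdec p q α A₁ hp hpq hq2 hα0 hα1 hloc s hs hcond
  have ha0 : 0 < -Real.log α := neg_pos.2 (Real.log_neg hα0 hα1)
  have hKa : 0 < K / (-Real.log α) := by positivity
  have hs1 : 1 / s ≤ 1 := by rw [div_le_one (by linarith)]; exact hs
  have hp1 : 1 < p := by
    have : 1 / p < 1 := by linarith
    rwa [div_lt_one (by linarith)] at this
  have hq1 : 1 < q := by linarith
  -- At `s = 1` there is no finite conjugate exponent, but the trivial bound of `f^` by `‖f‖_1`
  -- suffices.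
  rcases hs.eq_or_lt with rfl | hs1'
  · have hσ : σ Set.univ ^ (1 / q) ≠ ⊤ :=
      ENNReal.rpow_ne_top_of_nonneg (by positivity) (measure_ne_top _ _)
    refine ⟨(σ Set.univ ^ (1 / q)).toReal, fun f hf => ?_⟩
    rw [ENNReal.ofReal_toReal hσ, ENNReal.ofReal_one, eLpNorm_one_eq_lintegral_enorm, mul_comm]
    exact eLpNorm_le_of_enorm_le (by linarith) fun ξ => enorm_fourier_le_lintegral f ξ
  have hpp := Real.HolderConjugate.conjExponent hp1
  have hqq := Real.HolderConjugate.conjExponent hq1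
  have hss := Real.HolderConjugate.conjExponent hs1'
  set p' := p.conjExponent
  set q' := q.conjExponent
  set s' := s.conjExponent
  have hp'i : 1 / p' = 1 - 1 / p := by
    have := hpp.inv_add_inv_eq_one
    rw [one_div, one_div]; linarith
  have hs'i : 1 / s' = 1 - 1 / s := by
    have := hss.inv_add_inv_eq_one
    rw [one_div, one_div]; linarith
  have hs'0 : 0 < s' := hss.symm.pos
  have hp'2 : 2 ≤ p' := by
    have hp'0 : 0 < p' := hpp.symm.pos
    have h1 : 1 / p' ≤ 1 / 2 := by
      rw [hp'i]
      have : 1 / 2 ≤ 1 / p := one_div_le_one_div_of_le (by linarith) (by linarith)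
      linarith
    exact (one_div_le_one_div hp'0 two_pos).1 h1
  obtain ⟨N, hN, hε, hr⟩ := exists_scale_count hB (d := (Module.finrank ℝ V : ℝ))
    (Nat.cast_nonneg _) hK hα0 rfl hp'2 ha0 (by rw [hp'i]; linarith)
  set r := (p' + Module.finrank ℝ V) / (1 - (1 / N + α * p' * (2 * c + 1 : ℝ) ^ N)) -
    Module.finrank ℝ V with hrdef
  -- In conjugate exponents the hypothesis on `s` reads `1/s' < 1/p' - K / (-log α)`, and the right
  -- side is at most `1/r`.
  have hrs : r < s' := by
    have hs'i0 : 0 < 1 / s' := by positivity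
    have h1 : 1 / s' < 1 / r := by rw [hs'i]; linarith
    have hr0 : 0 < r := by
      have : 0 < 1 / r := by linarith
      exact one_div_pos.1 this
    exact (one_div_lt_one_div hs'0 hr0).1 h1
  obtain ⟨C₁, hC₁, hdual⟩ := exists_dual_sparse_estimate hM hρ hdec hp hpq hq2 hqq hα0.le hloc
  set S := (σ Set.univ ^ (1 / q)).toReal with hS
  have hS0 : 0 ≤ S := ENNReal.toReal_nonneg
  -- One constant that is both a sup bound and a Lipschitz constant for all extensions of normalized
  -- `g`; the final `+ 1` keeps it positive.
  set L := (2 * Real.pi * max M 0 + 1) * S + 1 with hL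
  have hM0 : 0 ≤ max M 0 := le_max_right _ _
  have hπ := Real.pi_pos
  have hL0 : 0 < L := by positivity
  have hSL : S ≤ L := by
    have : 0 ≤ 2 * Real.pi * max M 0 * S := by positivity
    rw [hL]; linarith
  obtain ⟨C, hC0, hC⟩ := exists_volume_superlevel_le (V := V) hρ hα0.le hpp hL0 hC₁ hN hc3 hc hε
  set Q := ENNReal.ofReal s' *
    ∫⁻ lam in Set.Ioc 0 L, ENNReal.ofReal (C * lam ^ (s' - 1 - r)) with hQ
  have hQt : Q ≠ ⊤ := ENNReal.mul_ne_top ENNReal.ofReal_ne_top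
    (lintegral_Ioc_rpow_ne_top hL0.le (by linarith))
  have hext : ∀ g : V → ℂ, Integrable g σ → ∫⁻ ξ, ‖g ξ‖ₑ ^ q' ∂σ ≤ 1 →
      ∫⁻ x, ‖fourierExtension σ g x‖ₑ ^ s' ≤ Q := by
    intro g hg hg1
    have hgS := integral_norm_le_of_lintegral_rpow_le_one hqq hg hg1
    have hg0 : 0 ≤ ∫ ξ, ‖g ξ‖ ∂σ := integral_nonneg fun ξ => norm_nonneg _
    have hGc := continuous_fourierExtension hg
    refine lintegral_enorm_rpow_le_of_superlevel hGc.measurable hs'0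
      (fun x => (norm_fourierExtension_le σ g x).trans (hgS.trans hSL)) hC0
      (hC _ hGc (fun x y => (norm_fourierExtension_sub_le hM hg x y).trans ?_) (hdual g hg hg1))
    gcongr
    calc 2 * Real.pi * M * ∫ ξ, ‖g ξ‖ ∂σ ≤ 2 * Real.pi * max M 0 * S := by
          gcongr
          exact le_max_left _ _
      _ ≤ L := by rw [hL]; linarith
  have hQs : Q ^ (1 / s') ≠ ⊤ := ENNReal.rpow_ne_top_of_nonneg (by positivity) hQt
  refine ⟨(Q ^ (1 / s')).toReal, fun f hf => ?_⟩
  rw [ENNReal.ofReal_toReal hQs]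
  exact eLpNorm_fourier_le_of_fourierExtension hqq hss hext hf

/-- A local restriction estimate on a compact set forces the measure to be finite: test it on a
bump concentrated near the origin. -/
theorem isFiniteMeasure_of_eLpNorm_fourier_lt_top {σ : Measure V} {M q : ℝ} (hq : 0 < q)
    (hM : σ (Metric.closedBall 0 M)ᶜ = 0)
    (h : ∀ f : V → ℂ, ContDiff ℝ ∞ f → tsupport f ⊆ Metric.ball 0 1 →
      eLpNorm (𝓕 f) (ENNReal.ofReal q) σ < ⊤) : IsFiniteMeasure σ := by
  have hπ := Real.pi_pos
  set M' := max M 0 with hM'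
  have hM'0 : 0 ≤ M' := le_max_right _ _
  -- For `|x| < δ` and `|ξ| ≤ M'` the phase `2π⟨x, ξ⟩` is at most `1/2`, so the transform of the
  -- bump stays at least half its integral on the ball carrying `σ`; a finite `L^q` norm then bounds
  -- the mass.
  set δ := min (1 / 2) (1 / (4 * Real.pi * (M' + 1))) with hδ
  have hδ0 : 0 < δ := by positivity
  have hδ2 : δ ≤ 1 / 2 := min_le_left _ _
  have hδM : 2 * Real.pi * (δ * M') ≤ 1 / 2 := by
    have h1 : δ ≤ 1 / (4 * Real.pi * (M' + 1)) := min_le_right _ _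
    rw [le_div_iff₀ (by positivity)] at h1
    nlinarith [mul_pos hδ0 hπ]
  let b : ContDiffBump (0 : V) := ⟨δ / 2, δ, by positivity, by linarith⟩
  set f : V → ℂ := fun x => (b x : ℂ) with hf
  have hfs : ContDiff ℝ ∞ f := Complex.ofRealCLM.contDiff.comp b.contDiff
  have hbi : Integrable f := b.integrable.ofReal
  have hft : tsupport f ⊆ Metric.ball 0 1 := by
    have h1 : Function.support f = Function.support b := by ext x; simp [hf]
    rw [tsupport, h1]
    change tsupport b ⊆ _
    rw [b.tsupport_eq]
    exact Metric.closedBall_subset_ball (by change δ < 1; linarith)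
  set I := ∫ x, b x with hI
  have hI0 : 0 < I := b.integral_pos
  have hlow : ∀ ξ ∈ Metric.closedBall (0 : V) M, I / 2 ≤ ‖𝓕 f ξ‖ := by
    intro ξ hξ
    have hξM : ‖ξ‖ ≤ M' := (mem_closedBall_zero_iff.1 hξ).trans (le_max_left _ _)
    have hdiff : ‖𝓕 f ξ - (I : ℂ)‖ ≤ I / 2 := by
      have h1 : 𝓕 f ξ - (I : ℂ) = ∫ x, (𝐞 (-inner ℝ x ξ) • f x - f x) := by
        rw [integral_sub ((Real.fourierIntegral_convergent_iff ξ).2 hbi) hbi, hI,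
          ← integral_complex_ofReal]
        rfl
      rw [h1]
      calc _ ≤ ∫ x, 1 / 2 * b x := by
            refine norm_integral_le_of_norm_le (b.integrable.const_mul _)
              (Filter.Eventually.of_forall fun x => ?_)
            have h2 : 𝐞 (-inner ℝ x ξ) • f x - f x = ((𝐞 (-inner ℝ x ξ) : ℂ) - 1) * f x := by
              rw [Circle.smul_def, smul_eq_mul]; ring
            rw [h2, norm_mul]
            have h3 : ‖f x‖ = b x := by
              rw [hf, Complex.norm_real, Real.norm_of_nonneg b.nonneg]
            rw [h3]
            by_cases hx : ‖x‖ < δ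
            · refine mul_le_mul_of_nonneg_right ?_ b.nonneg
              rw [Real.fourierChar_apply, mul_comm _ Complex.I]
              refine Real.norm_exp_I_mul_ofReal_sub_one_le.trans ?_
              rw [norm_mul, Real.norm_of_nonneg (by positivity), norm_neg]
              refine le_trans ?_ hδM
              gcongr
              refine (norm_inner_le_norm _ _).trans ?_
              gcongr
            · have : b x = 0 := b.zero_of_le_dist (by rw [dist_zero_right]; exact not_lt.1 hx)
              rw [this]; simp
        _ = _ := by rw [integral_const_mul]; ring
    have h4 : ‖(I : ℂ)‖ = I := by rw [Complex.norm_real, Real.norm_of_nonneg hI0.le]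
    have h5 := norm_sub_norm_le (I : ℂ) (𝓕 f ξ)
    rw [h4, norm_sub_rev] at h5
    linarith
  have hmem : MemLp (𝓕 f) (ENNReal.ofReal q) σ :=
    ⟨(continuous_fourier hbi).aestronglyMeasurable, h f hfs hft⟩
  have hlt := hmem.meas_ge_lt_top (by simpa using hq) ENNReal.ofReal_ne_top
    (ε := (I / 2).toNNReal) (by simpa using hI0)
  refine ⟨lt_of_le_of_lt ?_ hlt⟩
  have hae : ∀ᵐ ξ ∂σ, ξ ∈ Metric.closedBall (0 : V) M := by rwa [ae_iff]
  refine measure_mono_ae ?_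
  filter_upwards [hae] with ξ hξ _
  change (I / 2).toNNReal ≤ ‖𝓕 f ξ‖₊
  rw [Real.toNNReal_le_iff_le_coe]
  exact hlow ξ hξ

end EpsilonRemoval

/-! ### Specialization to surface measure. -/

theorem surfaceMeasure_compl_eq_zero {d : ℕ} {S B : Set (EuclideanSpace ℝ (Fin d))}
    (hSB : S ⊆ B) (hB : MeasurableSet B) : surfaceMeasure S Bᶜ = 0 := by
  rw [surfaceMeasure, Measure.restrict_apply hB.compl,
    (Set.disjoint_compl_left_iff_subset.2 hSB).inter_eq, measure_empty]

theorem surfaceFourier_eq {d : ℕ} (S : Set (EuclideanSpace ℝ (Fin d)))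
    (ξ : EuclideanSpace ℝ (Fin d)) :
    surfaceFourier S ξ = ∫ x, (𝐞 (-inner ℝ x ξ) : ℂ) ∂(surfaceMeasure S) := by
  rw [surfaceFourier]
  congr 1; ext x
  rw [Real.fourierChar_apply]
  congr 3; ring

theorem theoremA1 (d : ℕ) (ρ : ℝ) (hρ : 0 < ρ) :
    ∃ K : ℝ, 0 < K ∧
      ∀ S : Set (EuclideanSpace ℝ (Fin d)), IsCompactSmoothHypersurface S → HasFourierDecay S ρ →
      ∀ p q α : ℝ, 1 ≤ p → p ≤ q → q ≤ 2 → 0 < α → α < 1 →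
        LocalRestrictionEstimate S p q α →
          ∀ s : ℝ, 1 ≤ s → 1 / p + K / (-Real.log α) < 1 / s →
            GlobalRestrictionEstimate S s q := by
  obtain ⟨K, hK0, hK⟩ := exists_global_restriction (EuclideanSpace ℝ (Fin d)) hρ
  refine ⟨K, hK0, ?_⟩
  rintro S hS ⟨A, hA⟩ p q α hp hpq hq2 hα0 hα1 ⟨A₁, hloc⟩ s hs hcond
  obtain ⟨M, hSM⟩ := hS.isCompact.isBounded.subset_closedBall 0
  have hM : surfaceMeasure S (Metric.closedBall 0 M)ᶜ = 0 :=
    surfaceMeasure_compl_eq_zero hSM measurableSet_closedBall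
  -- Finiteness of the surface measure is extracted from the local restriction estimate with `R =
  -- 1`, so no area computation in charts is needed.
  have hfin : IsFiniteMeasure (surfaceMeasure S) := by
    refine isFiniteMeasure_of_eLpNorm_fourier_lt_top (q := q) (by linarith) hM fun f hf hft => ?_
    refine (hloc 1 le_rfl 0 f hf hft).trans_lt (ENNReal.mul_lt_top ENNReal.ofReal_lt_top ?_)
    have hfc : HasCompactSupport f :=
      HasCompactSupport.of_support_subset_isCompact (isCompact_closedBall 0 1)
        ((subset_tsupport f).trans (hft.trans Metric.ball_subset_closedBall))
    exact ((hf.continuous.memLp_of_hasCompactSupport hfc).restrict _).2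
  simp_rw [surfaceFourier_eq] at hA
  obtain ⟨A₃, hA₃⟩ := hK (surfaceMeasure S) M A hM hA p q α A₁ hp hpq hq2 hα0 hα1
    (fun R hR c f hf hfs => eLpNorm_fourier_le_of_smooth hp (hp.trans hpq) hloc hR c hf hfs) s hs
    hcond
  exact ⟨A₃, fun f hf _ => hA₃ f hf⟩
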